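/- Let $\mathcal H$ be a separable complex Hilbert space. An antilinear operator on $\mathcal H$ is an additive map $A:\mathcal H\to\mathcal H$ with $A(\lambda x)=\overline{\lambda}\,Ax$ for all $\lambda\in\mathbb C$, $x\in\mathcal H$. The adjoint $A^*$ of a bounded antilinear operator $A$ is the bounded antilinear operator determined by $(Ax,y)=\overline{(x,A^*y)}$ for all $x,y\in\mathcal H$, and $A$ is self-adjoint if $A=A^*$. An antilinear operator $D$ is diagonalizable if there are an orthonormal basis $\{e_n\}$ of $\mathcal H$ and complex numbers $d_n$ with $De_n=d_ne_n$ for all $n$. For a compact antilinear operator $K$, the singular values $s_1(K)\ge s_2(K)\ge\cdots\ge 0$ are the eigenvalues of the positive complex linear operator $|K|=(K^*K)^{1/2}$ in non-increasing order, repeated according to multiplicity (continued by zeros if only finitely many of them are positive), and $\|K\|_p=\bigl(\sum_n s_n(K)^p\bigr)^{1/p}\in[0,\infty]$. **Theorem.** Let $A$ be a bounded self-adjoint antilinear operator on $\mathcal H$, let $\varepsilon>0$ and let $1<p<\infty$. Then there is a bounded self-adjoint antilinear operator $D$ on $\mathcal H$ which is diagonalizable and such that $A-D$ is compact and $\|A-D\|_p<\varepsilon$.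 -/

import Mathlib

open scoped ENNReal ComplexConjugate InnerProductSpace

noncomputable section

universe u

variable {H : Type u} [NormedAddCommGroup H] [InnerProductSpace ℂ H] [CompleteSpace H]

/-- The adjoint `A*` of a bounded antilinear operator `A` on a complex Hilbert space: `A* y` is the
Riesz representative of the bounded complex linear functional `x ↦ ⟪A x, y⟫`. It is the unique
operator with `⟪A x, y⟫ = conj ⟪x, A* y⟫`, equivalently `re ⟪A x, y⟫ = re ⟪x, A* y⟫`; see
`antilinearAdjoint_spec`, `antilinearAdjoint_re_spec` and `eq_antilinearAdjoint_iff`. -/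
def antilinearAdjoint (A : H →L⋆[ℂ] H) : H →L⋆[ℂ] H :=
  LinearMap.mkContinuous
    { toFun := fun y => (InnerProductSpace.toDual ℂ H).symm
        (LinearMap.mkContinuous
          { toFun := fun x => ⟪A x, y⟫_ℂ
            map_add' := fun x x' => by rw [map_add, inner_add_left]
            map_smul' := fun c x => by
              rw [map_smulₛₗ, inner_smul_left, Complex.conj_conj, RingHom.id_apply, smul_eq_mul] }
          (‖A‖ * ‖y‖) (fun x => by
            calc ‖⟪A x, y⟫_ℂ‖ ≤ ‖A x‖ * ‖y‖ := norm_inner_le_norm _ _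
              _ ≤ (‖A‖ * ‖x‖) * ‖y‖ := by gcongr; exact A.le_opNorm x
              _ = ‖A‖ * ‖y‖ * ‖x‖ := by ring))
      map_add' := fun y y' => by
        refine ext_inner_right ℂ fun x => ?_
        simp [inner_add_left]
      map_smul' := fun c y => by
        refine ext_inner_right ℂ fun x => ?_
        simp [inner_smul_left] }
    ‖A‖ (fun y => by
      simp only [LinearMap.coe_mk, AddHom.coe_mk, LinearIsometryEquiv.norm_map]
      exact LinearMap.mkContinuous_norm_le _ (by positivity) _)

theorem antilinearAdjoint_inner (A : H →L⋆[ℂ] H) (x y : H) :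
    ⟪antilinearAdjoint A y, x⟫_ℂ = ⟪A x, y⟫_ℂ := by
  simp [antilinearAdjoint]

theorem antilinearAdjoint_spec (A : H →L⋆[ℂ] H) (x y : H) :
    ⟪A x, y⟫_ℂ = conj ⟪x, antilinearAdjoint A y⟫_ℂ := by
  rw [inner_conj_symm, antilinearAdjoint_inner]

theorem antilinearAdjoint_re_spec (A : H →L⋆[ℂ] H) (x y : H) :
    (⟪A x, y⟫_ℂ).re = (⟪x, antilinearAdjoint A y⟫_ℂ).re := by
  rw [antilinearAdjoint_spec, Complex.conj_re]

theorem eq_antilinearAdjoint_iff (A B : H →L⋆[ℂ] H) :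
    B = antilinearAdjoint A ↔ ∀ x y : H, (⟪A x, y⟫_ℂ).re = (⟪x, B y⟫_ℂ).re := by
  constructor
  · rintro rfl
    exact antilinearAdjoint_re_spec A
  · intro h
    ext y
    rw [← sub_eq_zero, ← inner_self_eq_zero (𝕜 := ℂ)]
    have h1 := h (B y - antilinearAdjoint A y) y
    rw [antilinearAdjoint_re_spec] at h1
    have h2 : (⟪B y - antilinearAdjoint A y, B y - antilinearAdjoint A y⟫_ℂ).re = 0 := by
      rw [inner_sub_right, Complex.sub_re, h1, sub_self]
    rw [← inner_self_ofReal_re (𝕜 := ℂ), RCLike.re_to_complex, h2]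
    rfl

/-- A bounded antilinear operator is self-adjoint if `A* = A`. -/
def AntilinearSelfAdjoint (A : H →L⋆[ℂ] H) : Prop :=
  antilinearAdjoint A = A

/-- There is an orthonormal basis of the whole space consisting of eigenvectors of the antilinear
operator `A`, with arbitrary complex eigenvalues. -/
def AntilinearDiagonalizable (A : H →L⋆[ℂ] H) : Prop :=
  ∃ (ι : Type u) (e : HilbertBasis ι ℂ H) (a : ι → ℂ), ∀ i, A (e i) = a i • e i

/-- `|A| = (A* A)^(1/2)`, the positive square root (by the continuous functional calculus) of the
positive complex linear operator `A* A`. -/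
def antilinearAbs (A : H →L⋆[ℂ] H) : H →L[ℂ] H :=
  CFC.sqrt ((antilinearAdjoint A).comp A : H →L[ℂ] H)

theorem antilinearAdjoint_comp_self_nonneg (A : H →L⋆[ℂ] H) :
    0 ≤ ((antilinearAdjoint A).comp A : H →L[ℂ] H) := by
  rw [ContinuousLinearMap.nonneg_iff_isPositive, ContinuousLinearMap.isPositive_iff_complex]
  intro x
  have h : ⟪((antilinearAdjoint A).comp A : H →L[ℂ] H) x, x⟫_ℂ = ((‖A x‖ ^ 2 : ℝ) : ℂ) := by
    rw [ContinuousLinearMap.comp_apply, antilinearAdjoint_inner, inner_self_eq_norm_sq_to_K]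
    norm_cast
  rw [h]
  refine ⟨?_, ?_⟩
  · rw [RCLike.re_to_complex, Complex.ofReal_re]
  · rw [RCLike.re_to_complex, Complex.ofReal_re]; positivity

theorem antilinearAbs_nonneg (A : H →L⋆[ℂ] H) : 0 ≤ antilinearAbs A :=
  CFC.sqrt_nonneg _

theorem antilinearAbs_mul_self (A : H →L⋆[ℂ] H) :
    antilinearAbs A * antilinearAbs A = ((antilinearAdjoint A).comp A : H →L[ℂ] H) :=
  CFC.sqrt_mul_sqrt_self _ (antilinearAdjoint_comp_self_nonneg A)

/-- The span of all eigenvectors of `|A|` with eigenvalue at least `t`. Its dimension is the number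
of eigenvalues of `|A|`, counted with multiplicity, that are at least `t`. -/
def eigenspaceGE (A : H →L⋆[ℂ] H) (t : ℝ) : Submodule ℂ H :=
  ⨆ (l : ℝ) (_ : t ≤ l), Module.End.eigenspace (antilinearAbs A : H →ₗ[ℂ] H) (l : ℂ)

/-- The singular values of a compact antilinear operator `A`, numbered from `0`: the eigenvalues of
`|A|` repeated according to multiplicity and listed in non-increasing order (followed by zeros if
only finitely many of them are positive). The `n`-th one is the largest `t > 0` such that at least
`n + 1` eigenvalues of `|A|`, counted with multiplicity, are `≥ t`, and is `0` if there is no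
such `t`. -/
def antilinearSingularValue (A : H →L⋆[ℂ] H) (n : ℕ) : ℝ :=
  sSup {t : ℝ | 0 < t ∧ ((n + 1 : ℕ) : Cardinal) ≤ Module.rank ℂ (eigenspaceGE A t)}

/-- The Schatten `p`-norm `(∑ sₙ(A) ^ p) ^ (1 / p)` of a compact antilinear operator, with values
in `[0, ∞]`; it is finite exactly if `A` is in the Schatten `p`-class. -/
def antilinearSchattenNorm (p : ℝ) (A : H →L⋆[ℂ] H) : ℝ≥0∞ :=
  (∑' n : ℕ, ENNReal.ofReal (antilinearSingularValue A n) ^ p) ^ (1 / p)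

end

noncomputable section

set_option linter.unusedSectionVars false

variable {H : Type u} [NormedAddCommGroup H] [InnerProductSpace ℂ H] [CompleteSpace H]

/-! This is a Weyl–von Neumann argument. The operator `A²` is complex linear and positive, and `A`
commutes with its real functional calculus. Cut `√(A²)` into about `‖A‖ / h` spectral bands of width
`h`. On the `k`-th band, `A` is within `h` of `k h J`, where `J` is an antilinear phase with `J² =
1` on every band `k ≥ 1`; on band `0`, `A` itself has norm at most `h`. Projecting a basis of a
finite-dimensional `V` to the bands and adding the images under `J` gives a space `W ⊇ V` of
dimension `O(dim V / h)` that is invariant under `A` up to an error `h`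
(`AntilinearSelfAdjoint.exists_almost_invariant`).

The cost `dim W * h ^ p` is thus `O(h ^ (p - 1))`, which is arbitrarily small because `p > 1`.
Iterating along a dense sequence yields finite-dimensional `V m` with dense union, where `V (m + 1)`
has invariance error `h m` (`AntilinearSelfAdjoint.exists_filtration`). Let `K` be the part of `A`
off the diagonal blocks `(V m)ᗮ ⊓ V (m + 1)`. Then `D = A - K` preserves every block, and Takagi
diagonalization of the blocks gives an eigenbasis
(`AntilinearSelfAdjoint.diagonalizable_of_blocks`). On the complement of `V m + A (V m)` the norm of
`K` is at most `4 h m`; by min-max this bounds the singular values from index `2 dim (V m)` on, and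
summing over `m` bounds the Schatten norm (`antilinearSchattenNorm_le`). -/

/-! ### Self-adjoint antilinear operators and the functional calculus of `A²`. -/

theorem AntilinearSelfAdjoint.inner_comm {A : H →L⋆[ℂ] H} (hA : AntilinearSelfAdjoint A)
    (x y : H) : ⟪A x, y⟫_ℂ = ⟪A y, x⟫_ℂ := by
  rw [← antilinearAdjoint_inner, hA]

theorem antilinearSelfAdjoint_of_inner_comm {A : H →L⋆[ℂ] H}
    (h : ∀ x y : H, ⟪A x, y⟫_ℂ = ⟪A y, x⟫_ℂ) : AntilinearSelfAdjoint A := by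
  ext y
  refine ext_inner_right ℂ fun x => ?_
  rw [antilinearAdjoint_inner, h]

/-- The square of an antilinear operator, a complex linear operator. -/
def antilinearSq (A : H →L⋆[ℂ] H) : H →L[ℂ] H := A.comp A

theorem antilinearSq_apply (A : H →L⋆[ℂ] H) (x : H) : antilinearSq A x = A (A x) := rfl

theorem AntilinearSelfAdjoint.nonneg_sq {A : H →L⋆[ℂ] H} (hA : AntilinearSelfAdjoint A) :
    0 ≤ antilinearSq A := by
  have h := antilinearAdjoint_comp_self_nonneg A
  rwa [hA] at h

theorem AntilinearSelfAdjoint.isSelfAdjoint_sq {A : H →L⋆[ℂ] H} (hA : AntilinearSelfAdjoint A) :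
    IsSelfAdjoint (antilinearSq A) :=
  hA.nonneg_sq.isSelfAdjoint

theorem AntilinearSelfAdjoint.norm_apply_sq {A : H →L⋆[ℂ] H} (hA : AntilinearSelfAdjoint A)
    (x : H) : ‖A x‖ ^ 2 = (⟪antilinearSq A x, x⟫_ℂ).re := by
  rw [antilinearSq_apply, hA.inner_comm]
  exact (inner_self_eq_norm_sq (𝕜 := ℂ) _).symm

/-- The complex linear operators that commute with a self-adjoint antilinear operator. -/
def AntilinearSelfAdjoint.commutant {A : H →L⋆[ℂ] H} (hA : AntilinearSelfAdjoint A) :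
    StarSubalgebra ℝ (H →L[ℂ] H) where
  carrier := {B | ∀ x, A (B x) = B (A x)}
  mul_mem' {B C} hB hC x := by
    simp only [Set.mem_ofPred_eq] at hB hC
    simp [hB, hC]
  add_mem' {B C} hB hC x := by
    simp only [Set.mem_ofPred_eq] at hB hC
    simp [hB, hC]
  algebraMap_mem' r x := by
    have h : ∀ y : H, algebraMap ℝ (H →L[ℂ] H) r y = (r : ℂ) • y := fun y => by
      simp [Algebra.algebraMap_eq_smul_one]
    rw [h, h, map_smulₛₗ, Complex.conj_ofReal]
  star_mem' {B} hB x := by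
    refine ext_inner_right ℂ fun y => ?_
    simp only [Set.mem_ofPred_eq] at hB
    rw [ContinuousLinearMap.star_eq_adjoint, ContinuousLinearMap.adjoint_inner_left,
      hA.inner_comm, ContinuousLinearMap.adjoint_inner_right, ← hB, hA.inner_comm]

theorem AntilinearSelfAdjoint.isClosed_commutant {A : H →L⋆[ℂ] H}
    (hA : AntilinearSelfAdjoint A) : IsClosed (hA.commutant : Set (H →L[ℂ] H)) := by
  have : (hA.commutant : Set (H →L[ℂ] H)) = ⋂ x, {B | A (B x) = B (A x)} := by
    ext B
    simp only [Set.mem_iInter]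
    rfl
  rw [this]
  refine isClosed_iInter fun x => isClosed_eq ?_ ?_
  · exact A.continuous.comp (ContinuousLinearMap.apply ℂ H x).continuous
  · exact (ContinuousLinearMap.apply ℂ H (A x)).continuous

/-- Since `A` conjugates scalars, its commutant is only a real algebra; that suffices for real `f`,
because the commutant is closed, star-stable and contains `A²`. -/
theorem AntilinearSelfAdjoint.apply_cfc {A : H →L⋆[ℂ] H} (hA : AntilinearSelfAdjoint A)
    (f : ℝ → ℝ) (x : H) : A (cfc f (antilinearSq A) x) = cfc f (antilinearSq A) (A x) := by
  have := hA.isClosed_commutant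
  have h : cfc f (antilinearSq A) ∈ hA.commutant := cfc_mem (𝕜' := ℝ) f fun x => rfl
  exact h x

theorem re_inner_le_of_le {S T : H →L[ℂ] H} (h : S ≤ T) (x : H) :
    (⟪S x, x⟫_ℂ).re ≤ (⟪T x, x⟫_ℂ).re := by
  have h1 := (ContinuousLinearMap.le_def S T).1 h
  have h2 := h1.re_inner_nonneg_left x
  rw [sub_apply, inner_sub_left] at h2
  simpa using h2

theorem norm_cfc_apply_sq (S : H →L[ℂ] H) {f : ℝ → ℝ}
    (hf : Continuous f) (x : H) :
    ‖cfc f S x‖ ^ 2 = (⟪cfc (fun s => f s * f s) S x, x⟫_ℂ).re := by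
  rw [cfc_mul f f S hf.continuousOn hf.continuousOn]
  have h1 : IsSelfAdjoint (cfc f S) := cfc_predicate f S
  rw [mul_apply_eq_comp, ← ContinuousLinearMap.adjoint_inner_right,
    ContinuousLinearMap.isSelfAdjoint_iff'.1 h1]
  exact (inner_self_eq_norm_sq (𝕜 := ℂ) _).symm

theorem AntilinearSelfAdjoint.norm_apply_cfc_sq {A : H →L⋆[ℂ] H} (hA : AntilinearSelfAdjoint A)
    {f : ℝ → ℝ} (hf : Continuous f) (x : H) :
    ‖A (cfc f (antilinearSq A) x)‖ ^ 2 =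
      (⟪cfc (fun s => s * (f s * f s)) (antilinearSq A) x, x⟫_ℂ).re := by
  have hS := hA.isSelfAdjoint_sq
  have h1 : IsSelfAdjoint (cfc f (antilinearSq A)) := cfc_predicate f _
  have h2 : cfc (fun s => s * (f s * f s)) (antilinearSq A) =
      cfc f (antilinearSq A) * (antilinearSq A * cfc f (antilinearSq A)) := by
    rw [show antilinearSq A * cfc f (antilinearSq A) =
      cfc (fun s => s * f s) (antilinearSq A) by
        rw [cfc_mul (fun s => s) f _ continuous_id.continuousOn hf.continuousOn, cfc_id' ℝ _ hS],
      ← cfc_mul f _ _ hf.continuousOn (by fun_prop)]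
    congr 1
    ext s
    ring
  rw [hA.norm_apply_sq, h2, mul_apply_eq_comp, mul_apply_eq_comp,
    ← ContinuousLinearMap.adjoint_inner_right (cfc f (antilinearSq A)),
    ContinuousLinearMap.isSelfAdjoint_iff'.1 h1]

/-! ### Spectral localization through kernels of cutoffs. -/

/-- The positive part of `S - t`. -/
def cfcAbove (S : H →L[ℂ] H) (t : ℝ) : H →L[ℂ] H := cfc (fun s : ℝ => max (s - t) 0) S

/-- The negative part of `S - t`. -/
def cfcBelow (S : H →L[ℂ] H) (t : ℝ) : H →L[ℂ] H := cfc (fun s : ℝ => max (t - s) 0) S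

/-- This replaces spectral measures: `x` behaves as if the spectrum of `S` lay in `[t', t]`. The
penalty multiplied by `C` may be as large as needed outside that interval, yet its operator kills
`x`. -/
theorem re_inner_cfc_le_of_mem_ker {S : H →L[ℂ] H} (hS : IsSelfAdjoint S) {t t' η C : ℝ} {x : H}
    (hx : cfcAbove S t x = 0) (hx' : cfcBelow S t' x = 0) {f : ℝ → ℝ} (hf : Continuous f)
    (h : ∀ s ∈ spectrum ℝ S, f s ≤ η ^ 2 + C * (max (s - t) 0 + max (t' - s) 0)) :
    (⟪cfc f S x, x⟫_ℂ).re ≤ (η * ‖x‖) ^ 2 := by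
  have h1 : cfc f S ≤
      cfc (fun s => η ^ 2 + C * (max (s - t) 0 + max (t' - s) 0)) S :=
    cfc_mono h hf.continuousOn (by fun_prop)
  have h2 : cfc (fun s => η ^ 2 + C * (max (s - t) 0 + max (t' - s) 0)) S x =
      ((η ^ 2 : ℝ) : ℂ) • x := by
    rw [cfc_const_add (η ^ 2) (fun s => C * (max (s - t) 0 + max (t' - s) 0)) S (by fun_prop),
      cfc_const_mul C (fun s => max (s - t) 0 + max (t' - s) 0) S (by fun_prop),
      cfc_add S (fun s => max (s - t) 0) (fun s => max (t' - s) 0) (by fun_prop) (by fun_prop)]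
    change (algebraMap ℝ (H →L[ℂ] H) (η ^ 2) + C • (cfcAbove S t + cfcBelow S t')) x = _
    simp only [Algebra.algebraMap_eq_smul_one, add_apply, smul_apply, hx, hx', add_zero, smul_zero]
    exact (Complex.coe_smul _ _).symm
  refine (re_inner_le_of_le h1 x).trans_eq ?_
  rw [h2, inner_smul_left, Complex.conj_ofReal, inner_self_eq_norm_sq_to_K, mul_pow,
    Complex.re_ofReal_mul]
  norm_cast

theorem norm_cfc_apply_le_of_mem_ker {S : H →L[ℂ] H} (hS : IsSelfAdjoint S) {t t' η C : ℝ} {x : H}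
    (hη : 0 ≤ η) (hx : cfcAbove S t x = 0) (hx' : cfcBelow S t' x = 0) {f : ℝ → ℝ}
    (hf : Continuous f)
    (h : ∀ s ∈ spectrum ℝ S, f s * f s ≤ η ^ 2 + C * (max (s - t) 0 + max (t' - s) 0)) :
    ‖cfc f S x‖ ≤ η * ‖x‖ := by
  refine le_of_sq_le_sq ?_ (by positivity)
  rw [norm_cfc_apply_sq S hf]
  exact re_inner_cfc_le_of_mem_ker hS hx hx' (hf.mul hf) h

theorem AntilinearSelfAdjoint.norm_apply_cfc_le_of_mem_ker {A : H →L⋆[ℂ] H}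
    (hA : AntilinearSelfAdjoint A) {t t' η C : ℝ} {x : H}
    (hη : 0 ≤ η) (hx : cfcAbove (antilinearSq A) t x = 0)
    (hx' : cfcBelow (antilinearSq A) t' x = 0) {f : ℝ → ℝ} (hf : Continuous f)
    (h : ∀ s : ℝ, 0 ≤ s → s * (f s * f s) ≤ η ^ 2 + C * (max (s - t) 0 + max (t' - s) 0)) :
    ‖A (cfc f (antilinearSq A) x)‖ ≤ η * ‖x‖ := by
  refine le_of_sq_le_sq ?_ (by positivity)
  rw [hA.norm_apply_cfc_sq hf]
  exact re_inner_cfc_le_of_mem_ker hA.isSelfAdjoint_sq hx hx' (by fun_prop)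
    fun s hs => h s (spectrum_nonneg_of_nonneg hA.nonneg_sq hs)

theorem cfcBelow_mul_cfcAbove (S : H →L[ℂ] H) (t : ℝ) : cfcBelow S t * cfcAbove S t = 0 := by
  rw [cfcBelow, cfcAbove, ← cfc_mul _ _ S (by fun_prop) (by fun_prop)]
  have : (fun s : ℝ => max (t - s) 0 * max (s - t) 0) = fun _ => 0 := by
    ext s
    rcases le_total s t with h | h
    · rw [max_eq_right (by linarith : s - t ≤ 0), mul_zero]
    · rw [max_eq_right (by linarith : t - s ≤ 0), zero_mul]
  rw [this, cfc_const_zero]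

/-- The orthogonal complement of the kernel of a self-adjoint operator is the closure of its range,
and `cfcBelow` vanishes on the range of `cfcAbove`. -/
theorem cfcBelow_apply_of_mem_orthogonal_ker {S : H →L[ℂ] H} {t : ℝ} {x : H}
    (hx : x ∈ (cfcAbove S t).kerᗮ) : cfcBelow S t x = 0 := by
  have h1 : IsSelfAdjoint (cfcAbove S t) := cfc_predicate _ _
  rw [ContinuousLinearMap.orthogonal_ker, ContinuousLinearMap.isSelfAdjoint_iff'.1 h1] at hx
  have h2 : (cfcAbove S t).range.topologicalClosure ≤ (cfcBelow S t).ker := by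
    refine Submodule.topologicalClosure_minimal _ ?_ (cfcBelow S t).isClosed_ker
    rintro _ ⟨y, rfl⟩
    exact DFunLike.congr_fun (cfcBelow_mul_cfcAbove S t) y
  exact h2 hx

theorem ker_cfcAbove_mono {S : H →L[ℂ] H} {t t' : ℝ} (h : t ≤ t') :
    (cfcAbove S t).ker ≤ (cfcAbove S t').ker := by
  intro x hx
  have h2 : ‖cfcAbove S t' x‖ ^ 2 ≤ ‖cfcAbove S t x‖ ^ 2 := by
    rw [cfcAbove, cfcAbove, norm_cfc_apply_sq S (by fun_prop), norm_cfc_apply_sq S (by fun_prop)]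
    refine re_inner_le_of_le (cfc_mono (fun s _ => ?_) (by fun_prop) (by fun_prop)) x
    have : max (s - t') 0 ≤ max (s - t) 0 := max_le_max (by linarith) le_rfl
    have : 0 ≤ max (s - t') 0 := le_max_right _ _
    gcongr
  have hx0 : cfcAbove S t x = 0 := hx
  rw [hx0] at h2
  simpa using h2

theorem ker_cfcAbove_eq_top {S : H →L[ℂ] H} {t : ℝ} (h : ‖S‖ ≤ t) :
    (cfcAbove S t).ker = ⊤ := by
  have : cfcAbove S t = 0 := by
    rw [cfcAbove, cfc_congr (g := fun _ => 0), cfc_const_zero]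
    intro s hs
    rcases subsingleton_or_nontrivial H with hH | hH
    · exact absurd hs (by simp [spectrum.of_subsingleton])
    · have := spectrum.norm_le_norm_of_mem hs
      simp only [Real.norm_eq_abs] at this
      exact max_eq_right (by linarith [le_abs_self s])
  rw [this]
  ext
  simp

/-! ### Reducing subspaces and the spectral bands. -/

theorem Submodule.apply_starProjection_of_reducing {σ : ℂ →+* ℂ} (N : Submodule ℂ H)
    [N.HasOrthogonalProjection] (T : H →SL[σ] H) (h : ∀ x ∈ N, T x ∈ N)
    (h' : ∀ x ∈ Nᗮ, T x ∈ Nᗮ) (x : H) : T (N.starProjection x) = N.starProjection (T x) := by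
  refine (Submodule.eq_starProjection_of_mem_orthogonal (h _ (N.starProjection_apply_mem x)) ?_).symm
  rw [← map_sub]
  exact h' _ (N.sub_starProjection_mem_orthogonal x)

theorem AntilinearSelfAdjoint.apply_mem_orthogonal {A : H →L⋆[ℂ] H}
    (hA : AntilinearSelfAdjoint A) {N : Submodule ℂ H} (h : ∀ x ∈ N, A x ∈ N) {x : H}
    (hx : x ∈ Nᗮ) : A x ∈ Nᗮ := by
  rw [Submodule.mem_orthogonal'] at hx ⊢
  intro y hy
  rw [hA.inner_comm, ← inner_conj_symm, hx _ (h y hy), map_zero]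

theorem IsSelfAdjoint.apply_mem_orthogonal {T : H →L[ℂ] H} (hT : IsSelfAdjoint T)
    {N : Submodule ℂ H} (h : ∀ x ∈ N, T x ∈ N) {x : H} (hx : x ∈ Nᗮ) : T x ∈ Nᗮ := by
  rw [Submodule.mem_orthogonal'] at hx ⊢
  intro y hy
  rw [← ContinuousLinearMap.adjoint_inner_right, ContinuousLinearMap.isSelfAdjoint_iff'.1 hT,
    hx _ (h y hy)]

/-- The spectral subspaces of `S` for the intervals `(-∞, (k h)²]`, starting with `⊥`. -/
def spectralSubspace (S : H →L[ℂ] H) (h : ℝ) : ℕ → Submodule ℂ H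
  | 0 => ⊥
  | k + 1 => (cfcAbove S (((k + 1 : ℕ) * h) ^ 2)).ker

instance (S : H →L[ℂ] H) (h : ℝ) (k : ℕ) : (spectralSubspace S h k).HasOrthogonalProjection := by
  cases k with
  | zero => unfold spectralSubspace; infer_instance
  | succ k =>
    unfold spectralSubspace
    have := (cfcAbove S (((k + 1 : ℕ) * h) ^ 2)).isClosed_ker.completeSpace_coe
    infer_instance

theorem spectralSubspace_mono (S : H →L[ℂ] H) {h : ℝ} (hh : 0 ≤ h) :
    Monotone (spectralSubspace S h) := by
  refine monotone_nat_of_le_succ fun k => ?_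
  cases k with
  | zero => exact bot_le
  | succ k => exact ker_cfcAbove_mono (by gcongr; simp)

theorem cfcBelow_apply_of_mem_orthogonal_spectralSubspace {S : H →L[ℂ] H} (hS : 0 ≤ S) {h : ℝ}
    {k : ℕ} {x : H} (hx : x ∈ (spectralSubspace S h k)ᗮ) : cfcBelow S ((k * h) ^ 2) x = 0 := by
  cases k with
  | zero =>
    have : cfcBelow S (((0 : ℕ) * h) ^ 2) = 0 := by
      rw [cfcBelow, cfc_congr (g := fun _ => 0), cfc_const_zero]
      intro s hs
      have := spectrum_nonneg_of_nonneg hS hs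
      simpa using this
    rw [this, zero_apply]
  | succ k => exact cfcBelow_apply_of_mem_orthogonal_ker hx

theorem cfc_apply_mem_spectralSubspace {S : H →L[ℂ] H} {h : ℝ} (f : ℝ → ℝ) (k : ℕ) (x : H)
    (hx : x ∈ spectralSubspace S h k) : cfc f S x ∈ spectralSubspace S h k := by
  cases k with
  | zero =>
    have : x = 0 := hx
    simp [this]
  | succ k =>
    have hx0 : cfcAbove S (((k + 1 : ℕ) * h) ^ 2) x = 0 := hx
    change cfcAbove S (((k + 1 : ℕ) * h) ^ 2) (cfc f S x) = 0
    have := DFunLike.congr_fun (cfc_commute_cfc (fun s => max (s - ((k + 1 : ℕ) * h) ^ 2) 0) f S).eq x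
    refine this.trans ?_
    change cfc f S (cfcAbove S (((k + 1 : ℕ) * h) ^ 2) x) = 0
    rw [hx0, map_zero]

theorem AntilinearSelfAdjoint.apply_mem_spectralSubspace {A : H →L⋆[ℂ] H}
    (hA : AntilinearSelfAdjoint A) {h : ℝ} (k : ℕ) (x : H)
    (hx : x ∈ spectralSubspace (antilinearSq A) h k) :
    A x ∈ spectralSubspace (antilinearSq A) h k := by
  cases k with
  | zero =>
    have : x = 0 := hx
    simp [this]
  | succ k =>
    have hx0 : cfcAbove (antilinearSq A) (((k + 1 : ℕ) * h) ^ 2) x = 0 := hx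
    change cfcAbove (antilinearSq A) (((k + 1 : ℕ) * h) ^ 2) (A x) = 0
    rw [cfcAbove, ← hA.apply_cfc]
    exact (congrArg A hx0).trans (map_zero A)

/-- The spectral projection of `S` for the interval `((k h)², ((k + 1) h)²]`, with `0` included
in the interval for `k = 0`. -/
def spectralProj (S : H →L[ℂ] H) (h : ℝ) (k : ℕ) : H →L[ℂ] H :=
  (spectralSubspace S h (k + 1)).starProjection - (spectralSubspace S h k).starProjection

theorem spectralProj_apply (S : H →L[ℂ] H) (h : ℝ) (k : ℕ) (x : H) :
    spectralProj S h k x = (spectralSubspace S h (k + 1)).starProjection x -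
      (spectralSubspace S h k).starProjection x := rfl

theorem Submodule.starProjection_starProjection_of_le {U V : Submodule ℂ H}
    [U.HasOrthogonalProjection] [V.HasOrthogonalProjection] (h : U ≤ V) (x : H) :
    U.starProjection (V.starProjection x) = U.starProjection x :=
  DFunLike.congr_fun (Submodule.starProjection_comp_starProjection_of_le h) x

theorem Submodule.starProjection_starProjection_of_ge {U V : Submodule ℂ H}
    [U.HasOrthogonalProjection] [V.HasOrthogonalProjection] (h : U ≤ V) (x : H) :
    V.starProjection (U.starProjection x) = U.starProjection x :=
  Submodule.starProjection_eq_self_iff.2 (h (U.starProjection_apply_mem x))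

/-- Differences of an increasing sequence of orthogonal projections are mutually orthogonal
projections. -/
theorem starProjection_sub_comp_sub {N : ℕ → Submodule ℂ H} [∀ k, (N k).HasOrthogonalProjection]
    (hN : Monotone N) (j k : ℕ) (x : H) :
    ((N (j + 1)).starProjection - (N j).starProjection)
      (((N (k + 1)).starProjection - (N k).starProjection) x) =
      if j = k then ((N (k + 1)).starProjection - (N k).starProjection) x else 0 := by
  simp only [sub_apply, map_sub]
  rcases lt_trichotomy j k with hjk | rfl | hjk
  · rw [if_neg hjk.ne, Submodule.starProjection_starProjection_of_le (hN (by omega)),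
      Submodule.starProjection_starProjection_of_le (hN (by omega)),
      Submodule.starProjection_starProjection_of_le (hN (by omega)),
      Submodule.starProjection_starProjection_of_le (hN (by omega))]
    simp
  · rw [if_pos rfl, Submodule.starProjection_starProjection_of_le (hN le_rfl),
      Submodule.starProjection_starProjection_of_le (hN (by omega)),
      Submodule.starProjection_starProjection_of_ge (hN (by omega)),
      Submodule.starProjection_starProjection_of_le (hN le_rfl)]
    simp
  · rw [if_neg hjk.ne', Submodule.starProjection_starProjection_of_ge (hN (by omega)),
      Submodule.starProjection_starProjection_of_ge (hN (by omega)),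
      Submodule.starProjection_starProjection_of_ge (hN (by omega)),
      Submodule.starProjection_starProjection_of_ge (hN (by omega))]
    simp

theorem spectralProj_spectralProj {S : H →L[ℂ] H} {h : ℝ} (hh : 0 ≤ h)
    (j k : ℕ) (x : H) : spectralProj S h j (spectralProj S h k x) =
      if j = k then spectralProj S h k x else 0 :=
  starProjection_sub_comp_sub (spectralSubspace_mono _ hh) j k x

theorem inner_spectralProj_left (S : H →L[ℂ] H) (h : ℝ) (k : ℕ) (x y : H) :
    ⟪spectralProj S h k x, y⟫_ℂ = ⟪x, spectralProj S h k y⟫_ℂ := by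
  rw [spectralProj_apply, spectralProj_apply, inner_sub_left, inner_sub_right,
    Submodule.inner_starProjection_left_eq_right, Submodule.inner_starProjection_left_eq_right]

theorem sum_spectralProj {S : H →L[ℂ] H} {h : ℝ} {n : ℕ} (hn : 0 < n) (hSn : ‖S‖ ≤ (n * h) ^ 2)
    (x : H) : ∑ k ∈ Finset.range n, spectralProj S h k x = x := by
  simp only [spectralProj_apply]
  rw [Finset.sum_range_sub (fun k => (spectralSubspace S h k).starProjection x)]
  obtain ⟨m, rfl⟩ : ∃ m, n = m + 1 := ⟨n - 1, by omega⟩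
  have h1 : (spectralSubspace S h (m + 1)).starProjection x = x := by
    rw [Submodule.starProjection_eq_self_iff, spectralSubspace, ker_cfcAbove_eq_top hSn]
    trivial
  have h2 : (spectralSubspace S h 0).starProjection x = 0 := by
    have := (spectralSubspace S h 0).starProjection_apply_mem x
    exact this
  rw [h1, h2, sub_zero]

theorem cfcAbove_spectralProj {S : H →L[ℂ] H} {h : ℝ} (hh : 0 ≤ h)
    (k : ℕ) (x : H) : cfcAbove S (((k + 1 : ℕ) * h) ^ 2) (spectralProj S h k x) = 0 := by
  have : spectralProj S h k x ∈ spectralSubspace S h (k + 1) :=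
    sub_mem (Submodule.starProjection_apply_mem _ _)
      (spectralSubspace_mono _ hh k.le_succ (Submodule.starProjection_apply_mem _ _))
  exact this

theorem cfcBelow_spectralProj {S : H →L[ℂ] H} (hS : 0 ≤ S) {h : ℝ} (hh : 0 ≤ h)
    (k : ℕ) (x : H) : cfcBelow S ((k * h) ^ 2) (spectralProj S h k x) = 0 := by
  refine cfcBelow_apply_of_mem_orthogonal_spectralSubspace hS ?_
  rw [← Submodule.starProjection_apply_eq_zero_iff, spectralProj_apply, map_sub,
    Submodule.starProjection_starProjection_of_le
      (spectralSubspace_mono _ hh k.le_succ),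
    Submodule.starProjection_starProjection_of_le le_rfl, sub_self]

theorem apply_spectralProj_of_reducing {σ : ℂ →+* ℂ} {S : H →L[ℂ] H} {h : ℝ} (T : H →SL[σ] H)
    (hT : ∀ k, ∀ x ∈ spectralSubspace S h k, T x ∈ spectralSubspace S h k)
    (hT' : ∀ k, ∀ x ∈ (spectralSubspace S h k)ᗮ, T x ∈ (spectralSubspace S h k)ᗮ) (k : ℕ) (x : H) :
    T (spectralProj S h k x) = spectralProj S h k (T x) := by
  rw [spectralProj_apply, spectralProj_apply, map_sub,
    Submodule.apply_starProjection_of_reducing _ T (hT _) (hT' _),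
    Submodule.apply_starProjection_of_reducing _ T (hT _) (hT' _)]

theorem AntilinearSelfAdjoint.apply_spectralProj {A : H →L⋆[ℂ] H}
    (hA : AntilinearSelfAdjoint A) {h : ℝ} (k : ℕ) (x : H) :
    A (spectralProj (antilinearSq A) h k x) = spectralProj (antilinearSq A) h k (A x) :=
  apply_spectralProj_of_reducing A hA.apply_mem_spectralSubspace
    (fun k _ hx => hA.apply_mem_orthogonal (hA.apply_mem_spectralSubspace k) hx) k x

theorem cfc_apply_spectralProj {S : H →L[ℂ] H} {h : ℝ} (f : ℝ → ℝ) (k : ℕ) (x : H) :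
    cfc f S (spectralProj S h k x) = spectralProj S h k (cfc f S x) :=
  apply_spectralProj_of_reducing (cfc f S) (cfc_apply_mem_spectralSubspace f)
    (fun k _ hx => IsSelfAdjoint.apply_mem_orthogonal (cfc_predicate f S)
      (cfc_apply_mem_spectralSubspace f k) hx) k x

/-! ### The antilinear phase on the bands. -/

/-- A regularized inverse square root. -/
def invSqrtReg (h s : ℝ) : ℝ := (√(max s (h ^ 2)))⁻¹

theorem continuous_invSqrtReg {h : ℝ} (hh : 0 < h) : Continuous (invSqrtReg h) := by
  refine Continuous.inv₀ (by fun_prop) fun s => (Real.sqrt_pos.2 ?_).ne'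
  exact lt_max_of_lt_right (by positivity)

/-- A regularization of the antiunitary factor of the polar decomposition of `A`. -/
def antilinearPhase (A : H →L⋆[ℂ] H) (h : ℝ) : H →L⋆[ℂ] H :=
  A.comp (cfc (invSqrtReg h) (antilinearSq A))

theorem antilinearPhase_apply (A : H →L⋆[ℂ] H) (h : ℝ) (x : H) :
    antilinearPhase A h x = A (cfc (invSqrtReg h) (antilinearSq A) x) := rfl

theorem AntilinearSelfAdjoint.phase_spectralProj {A : H →L⋆[ℂ] H}
    (hA : AntilinearSelfAdjoint A) {h : ℝ} (k : ℕ) (x : H) :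
    antilinearPhase A h (spectralProj (antilinearSq A) h k x) =
      spectralProj (antilinearSq A) h k (antilinearPhase A h x) := by
  rw [antilinearPhase_apply, antilinearPhase_apply, cfc_apply_spectralProj, hA.apply_spectralProj]

theorem AntilinearSelfAdjoint.phase_phase_spectralProj {A : H →L⋆[ℂ] H}
    (hA : AntilinearSelfAdjoint A) {h : ℝ} (hh : 0 < h) {k : ℕ} (hk : 1 ≤ k) (x : H) :
    antilinearPhase A h (antilinearPhase A h (spectralProj (antilinearSq A) h k x)) =
      spectralProj (antilinearSq A) h k x := by
  have hc := continuous_invSqrtReg hh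
  have hS := hA.isSelfAdjoint_sq
  set S := antilinearSq A with hSdef
  set y := spectralProj S h k x
  set φ := invSqrtReg h
  have h1 : antilinearPhase A h (antilinearPhase A h y) =
      cfc (fun s => s * (φ s * φ s)) S y := by
    rw [antilinearPhase_apply, antilinearPhase_apply, ← hA.apply_cfc, ← antilinearSq_apply,
      cfc_mul (fun s => s) _ S (by fun_prop) (by fun_prop),
      cfc_mul φ φ S (by fun_prop) (by fun_prop), cfc_id' ℝ S hS]
    rfl
  have h2 : cfc (fun s => s * (φ s * φ s) - 1) S y = cfc (fun s => s * (φ s * φ s)) S y - y := by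
    rw [cfc_sub (fun s => s * (φ s * φ s)) (fun _ => 1) S (by fun_prop) (by fun_prop),
      cfc_const_one ℝ S]
    rfl
  -- The function `s φ(s)² - 1` vanishes for `s ≥ h²`, and bands `k ≥ 1` lie there, so the
  -- localization lemma applies with `η = 0` and gives an equality. For `s < h²` the penalty absorbs
  -- the square with `C = 1 / h²`.
  have h3 : ‖cfc (fun s => s * (φ s * φ s) - 1) S y‖ ≤ 0 * ‖y‖ := by
    refine norm_cfc_apply_le_of_mem_ker (C := (h ^ 2)⁻¹) hS le_rfl
      (cfcAbove_spectralProj hh.le k x) (cfcBelow_spectralProj hA.nonneg_sq hh.le k x)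
      (by fun_prop) fun s hs => ?_
    have hs0 : 0 ≤ s := spectrum_nonneg_of_nonneg hA.nonneg_sq hs
    have hφ : φ s * φ s = (max s (h ^ 2))⁻¹ := by
      change (√(max s (h ^ 2)))⁻¹ * (√(max s (h ^ 2)))⁻¹ = _
      rw [← mul_inv, Real.mul_self_sqrt (hs0.trans (le_max_left _ _))]
    rw [hφ]
    have hpos : 0 < h ^ 2 := by positivity
    have hk' : (1 : ℝ) ≤ k := by exact_mod_cast hk
    have hkh : h ^ 2 ≤ (k * h) ^ 2 := by
      rw [mul_pow]
      exact le_mul_of_one_le_left hpos.le (one_le_pow₀ hk')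
    have ha : 0 ≤ max (s - ((k + 1 : ℕ) * h) ^ 2) 0 := le_max_right _ _
    have hb : (k * h) ^ 2 - s ≤ max ((k * h) ^ 2 - s) 0 := le_max_left _ _
    have hb0 : 0 ≤ max ((k * h) ^ 2 - s) 0 := le_max_right _ _
    rcases le_total (h ^ 2) s with hle | hle
    · rw [max_eq_left hle, mul_inv_cancel₀ (by linarith)]
      simp only [sub_self, mul_zero]
      positivity
    · rw [max_eq_right hle]
      calc (s * (h ^ 2)⁻¹ - 1) * (s * (h ^ 2)⁻¹ - 1)
          = (h ^ 2)⁻¹ * ((h ^ 2 - s) * ((h ^ 2 - s) * (h ^ 2)⁻¹)) := by field_simp; ring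
        _ ≤ (h ^ 2)⁻¹ * ((h ^ 2 - s) * 1) := by
          have : (h ^ 2 - s) * (h ^ 2)⁻¹ ≤ 1 := by
            rw [← div_eq_mul_inv, div_le_one hpos]
            linarith
          have : 0 ≤ h ^ 2 - s := by linarith
          gcongr
        _ ≤ 0 ^ 2 + (h ^ 2)⁻¹ * (max (s - ((k + 1 : ℕ) * h) ^ 2) 0 + max ((k * h) ^ 2 - s) 0) := by
          rw [zero_pow two_ne_zero, zero_add]
          gcongr
          linarith
  rw [zero_mul, norm_le_zero_iff, h2, sub_eq_zero] at h3
  rw [h1, h3]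

/-- With `s = r²` and `c = k h`, the difference corresponds to `(r - c)²` wherever `φ(s) = 1 / r`,
and `c ≤ r ≤ c + h` on the band. For `k = 0` the phase drops out and the claim bounds `A` itself. -/
theorem AntilinearSelfAdjoint.norm_sub_phase_le {A : H →L⋆[ℂ] H}
    (hA : AntilinearSelfAdjoint A) {h : ℝ} (hh : 0 < h) (k : ℕ) (x : H) :
    ‖A (spectralProj (antilinearSq A) h k x) -
      ((k * h : ℝ) : ℂ) • antilinearPhase A h (spectralProj (antilinearSq A) h k x)‖ ≤
      h * ‖spectralProj (antilinearSq A) h k x‖ := by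
  have hc := continuous_invSqrtReg hh
  have hS := hA.isSelfAdjoint_sq
  set S := antilinearSq A with hSdef
  set y := spectralProj S h k x
  set φ := invSqrtReg h with hφdef
  set c : ℝ := k * h with hcdef
  have hc0 : 0 ≤ c := by positivity
  have h1 : A y - (c : ℂ) • antilinearPhase A h y = A (cfc (fun s => 1 - c * φ s) S y) := by
    rw [cfc_sub (fun _ => 1) (fun s => c * φ s) S (by fun_prop) (by fun_prop),
      cfc_const_one ℝ S, cfc_const_mul c φ S (by fun_prop), sub_apply, map_sub, smul_apply,
      ← Complex.coe_smul, map_smulₛₗ, Complex.conj_ofReal]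
    rfl
  rw [h1]
  refine hA.norm_apply_cfc_le_of_mem_ker (C := 1) hh.le
      (cfcAbove_spectralProj hh.le k x) (cfcBelow_spectralProj hA.nonneg_sq hh.le k x)
      (by fun_prop) fun s hs => ?_
  have hk1 : ((k + 1 : ℕ) : ℝ) * h = c + h := by
    push_cast
    ring
  rw [hk1, one_mul, ← hcdef]
  have ha : s - (c + h) ^ 2 ≤ max (s - (c + h) ^ 2) 0 := le_max_left _ _
  have hb : c ^ 2 - s ≤ max (c ^ 2 - s) 0 := le_max_left _ _
  have ha0 : 0 ≤ max (s - (c + h) ^ 2) 0 := le_max_right _ _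
  have hb0 : 0 ≤ max (c ^ 2 - s) 0 := le_max_right _ _
  obtain ⟨r, hr, rfl⟩ : ∃ r : ℝ, 0 ≤ r ∧ s = r ^ 2 := ⟨√s, Real.sqrt_nonneg _, (Real.sq_sqrt hs).symm⟩
  rcases le_total h r with hle | hle
  · have hφr : φ (r ^ 2) = r⁻¹ := by
      rw [hφdef, invSqrtReg, max_eq_left (by gcongr), Real.sqrt_sq hr]
    have hr0 : 0 < r := hh.trans_le hle
    have : r ^ 2 * ((1 - c * r⁻¹) * (1 - c * r⁻¹)) = (r - c) ^ 2 := by field_simp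
    rw [hφr, this]
    rcases le_total r c with h2 | h2
    · nlinarith
    · rcases le_total r (c + h) with h3 | h3
      · nlinarith [mul_nonneg (sub_nonneg.2 h2) (sub_nonneg.2 h3)]
      · nlinarith
  -- Here the regularization is active. For `k ≥ 1` such `r` satisfy `r ≤ c`, so the penalty helps;
  -- for `k = 0` the bound is `r ≤ h`.
  · have hφr : φ (r ^ 2) = h⁻¹ := by
      rw [hφdef, invSqrtReg, max_eq_right (by gcongr), Real.sqrt_sq hh.le]
    rw [hφr]
    rcases Nat.eq_zero_or_pos k with hk | hk
    · have : c = 0 := by rw [hcdef, hk]; simp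
      have h4 : r ^ 2 ≤ h ^ 2 := by gcongr
      have h5 : r ^ 2 * ((1 - c * h⁻¹) * (1 - c * h⁻¹)) = r ^ 2 := by rw [this]; ring
      linarith
    · have hch : h ≤ c := by
        have : (1 : ℝ) ≤ k := by exact_mod_cast hk
        nlinarith
      have hu : r ^ 2 * ((1 - c * h⁻¹) * (1 - c * h⁻¹)) = (r / h) ^ 2 * (c - h) ^ 2 := by
        field_simp
        ring
      have hrh : (r / h) ^ 2 ≤ 1 := by
        rw [div_pow, div_le_one (by positivity)]
        gcongr
      rw [hu]
      nlinarith [mul_le_mul_of_nonneg_right hrh (sq_nonneg (c - h))]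

/-! ### Almost invariant finite-dimensional subspaces. -/

theorem norm_sum_sq_of_pairwise_inner_eq_zero {ι : Type*} (s : Finset ι) (v : ι → H)
    (hv : ∀ i j, i ≠ j → ⟪v i, v j⟫_ℂ = 0) : ‖∑ i ∈ s, v i‖ ^ 2 = ∑ i ∈ s, ‖v i‖ ^ 2 := by
  classical
  induction s using Finset.induction_on with
  | empty => simp
  | insert a s ha ih =>
    have h0 : ⟪v a, ∑ i ∈ s, v i⟫_ℂ = 0 := by
      rw [inner_sum]
      exact Finset.sum_eq_zero fun i hi => hv a i (by rintro rfl; exact ha hi)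
    rw [Finset.sum_insert ha, Finset.sum_insert ha, norm_add_sq (𝕜 := ℂ), h0, ih]
    simp

theorem inner_spectralProj_spectralProj {S : H →L[ℂ] H} {h : ℝ}
    (hh : 0 ≤ h) {j k : ℕ} (hjk : j ≠ k) (x y : H) :
    ⟪spectralProj S h j x, spectralProj S h k y⟫_ℂ = 0 := by
  rw [inner_spectralProj_left, spectralProj_spectralProj hh, if_neg hjk, inner_zero_right]

/-- Every finite-dimensional subspace is contained in one that is invariant under `A` up to an
error `h` and has dimension `O(1 / h)`. -/
theorem AntilinearSelfAdjoint.exists_almost_invariant {A : H →L⋆[ℂ] H}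
    (hA : AntilinearSelfAdjoint A) {h : ℝ} (hh : 0 < h) {n : ℕ} (hn : 0 < n)
    (hAn : ‖antilinearSq A‖ ≤ (n * h) ^ 2) (V : Submodule ℂ H) [FiniteDimensional ℂ V] :
    ∃ W : Submodule ℂ H, V ≤ W ∧ FiniteDimensional ℂ W ∧
      Module.finrank ℂ W ≤ n * (Module.finrank ℂ V * 2) ∧
      ∀ w ∈ W, ∃ w' ∈ W, ‖A w - w'‖ ≤ h * ‖w‖ := by
  set E := spectralProj (antilinearSq A) h with hE
  set J := antilinearPhase A h
  let b := Module.finBasis ℂ V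
  -- On bands `k ≥ 1` the phase swaps the two families of generators, because `J² = 1` there.
  let g : Fin n × Fin (Module.finrank ℂ V) × Bool → H := fun i =>
    if i.2.2 then J (E i.1 (b i.2.1)) else E i.1 (b i.2.1)
  let W := Submodule.span ℂ (Set.range g)
  have hgW : ∀ i, g i ∈ W := fun i => Submodule.subset_span ⟨i, rfl⟩
  have hEW : ∀ (k : Fin n) j, E k (b j) ∈ W := fun k j => by simpa [g] using hgW (k, j, false)
  have hJW : ∀ (k : Fin n) j, J (E k (b j)) ∈ W := fun k j => by simpa [g] using hgW (k, j, true)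
  have hsum : ∀ x, ∑ k ∈ Finset.range n, E k x = x := sum_spectralProj hn hAn
  have hVW : V ≤ W := by
    intro v hv
    have hbW : ∀ j, (b j : H) ∈ W := fun j => by
      rw [← hsum (b j)]
      exact Submodule.sum_mem _ fun k hk => hEW ⟨k, Finset.mem_range.1 hk⟩ j
    have h1 : ((∑ j, b.repr ⟨v, hv⟩ j • b j : V) : H) = v := by rw [b.sum_repr]
    rw [← h1, Submodule.coe_sum]
    exact Submodule.sum_mem _ fun j _ => W.smul_mem _ (hbW j)
  have hJE : ∀ w ∈ W, ∀ k, 1 ≤ k → k < n → J (E k w) ∈ W := by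
    intro w hw k hk hkn
    induction hw using Submodule.span_induction with
    | mem x hx =>
      obtain ⟨⟨i, j, t⟩, rfl⟩ := hx
      cases t with
      | false =>
        simp only [g, Bool.false_eq_true, if_false]
        rw [hE, spectralProj_spectralProj hh.le]
        split_ifs with hki
        · exact hJW i j
        · simp
      | true =>
        simp only [g, if_true]
        rw [hE, ← hA.phase_spectralProj, spectralProj_spectralProj hh.le]
        split_ifs with hki
        · rw [hA.phase_phase_spectralProj hh (hki ▸ hk)]
          exact hEW i j
        · simp
    | zero => simp
    | add x y _ _ hx hy => simpa using W.add_mem hx hy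
    | smul c x _ hx => simpa using W.smul_mem _ hx
  refine ⟨W, hVW, FiniteDimensional.span_of_finite ℂ (Set.finite_range g), ?_, fun w hw => ?_⟩
  · refine (finrank_range_le_card g).trans ?_
    simp
  -- On band `0` the phase need not preserve `W`, but that term has coefficient `0`.
  · refine ⟨∑ k ∈ Finset.range n, ((k * h : ℝ) : ℂ) • J (E k w), ?_, ?_⟩
    · refine Submodule.sum_mem _ fun k hk => ?_
      rcases Nat.eq_zero_or_pos k with rfl | hk0
      · simp
      · exact W.smul_mem _ (hJE w hw k hk0 (Finset.mem_range.1 hk))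
    · have h1 : A w - ∑ k ∈ Finset.range n, ((k * h : ℝ) : ℂ) • J (E k w) =
          ∑ k ∈ Finset.range n, (A (E k w) - ((k * h : ℝ) : ℂ) • J (E k w)) := by
        rw [Finset.sum_sub_distrib, ← map_sum, hsum]
      have h2 : ∀ k, A (E k w) - ((k * h : ℝ) : ℂ) • J (E k w) =
          E k (A w - ((k * h : ℝ) : ℂ) • J w) := fun k => by
        rw [map_sub, map_smul, hA.apply_spectralProj, hA.phase_spectralProj]
      -- The errors of different bands are orthogonal, so their squares add and the number of bands
      -- does not enter the bound.
      refine le_of_sq_le_sq ?_ (by positivity)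
      rw [h1, norm_sum_sq_of_pairwise_inner_eq_zero]
      · conv_rhs => rw [mul_pow, ← hsum w]
        rw [norm_sum_sq_of_pairwise_inner_eq_zero, Finset.mul_sum]
        · refine Finset.sum_le_sum fun k _ => ?_
          rw [← mul_pow]
          have := hA.norm_sub_phase_le hh k w
          gcongr
        · exact fun j k hjk => inner_spectralProj_spectralProj hh.le hjk _ _
      · intro j k hjk
        rw [h2, h2]
        exact inner_spectralProj_spectralProj hh.le hjk _ _

theorem norm_antilinearSq_le {A : H →L⋆[ℂ] H} : ‖antilinearSq A‖ ≤ ‖A‖ ^ 2 := by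
  refine ContinuousLinearMap.opNorm_le_bound _ (by positivity) fun x => ?_
  rw [antilinearSq_apply]
  calc ‖A (A x)‖ ≤ ‖A‖ * (‖A‖ * ‖x‖) :=
        (A.le_opNorm _).trans (by gcongr; exact A.le_opNorm x)
    _ = ‖A‖ ^ 2 * ‖x‖ := by ring

theorem AntilinearSelfAdjoint.exists_almost_invariant_finrank_le {A : H →L⋆[ℂ] H}
    (hA : AntilinearSelfAdjoint A) (V : Submodule ℂ H) [FiniteDimensional ℂ V] {h : ℝ}
    (hh : 0 < h) (h1 : h ≤ 1) :
    ∃ W : Submodule ℂ H, V ≤ W ∧ FiniteDimensional ℂ W ∧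
      (Module.finrank ℂ W : ℝ) ≤ (‖A‖ + 2) * (Module.finrank ℂ V * 2) / h ∧
      ∀ w ∈ W, ∃ w' ∈ W, ‖A w - w'‖ ≤ h * ‖w‖ := by
  obtain ⟨W, hVW, hW, hr, hinv⟩ := hA.exists_almost_invariant hh (n := ⌈‖A‖ / h⌉₊ + 1)
    (Nat.succ_pos _) (by
      refine norm_antilinearSq_le.trans ?_
      have : ‖A‖ / h ≤ ⌈‖A‖ / h⌉₊ := Nat.le_ceil _
      rw [div_le_iff₀ hh] at this
      gcongr
      push_cast
      linarith) V
  refine ⟨W, hVW, hW, ?_, hinv⟩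
  have h2 : (Module.finrank ℂ W : ℝ) ≤ ((⌈‖A‖ / h⌉₊ : ℝ) + 1) * (Module.finrank ℂ V * 2) := by
    exact_mod_cast hr
  have h3 : (⌈‖A‖ / h⌉₊ : ℝ) < ‖A‖ / h + 1 := Nat.ceil_lt_add_one (by positivity)
  refine h2.trans ?_
  rw [mul_div_right_comm]
  gcongr
  rw [add_div]
  have : 1 ≤ 1 / h := by rwa [le_div_iff₀ hh, one_mul]
  have h4 : 2 / h = 2 * (1 / h) := by ring
  linarith

/-! ### Upper bounds for singular values. -/

theorem norm_antilinearAbs_apply (K : H →L⋆[ℂ] H) (x : H) : ‖antilinearAbs K x‖ = ‖K x‖ := by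
  have h1 : IsSelfAdjoint (antilinearAbs K) := (antilinearAbs_nonneg K).isSelfAdjoint
  have h2 := DFunLike.congr_fun (antilinearAbs_mul_self K) x
  have h3 : ⟪antilinearAbs K x, antilinearAbs K x⟫_ℂ = ⟪K x, K x⟫_ℂ := by
    rw [← ContinuousLinearMap.adjoint_inner_left, ContinuousLinearMap.isSelfAdjoint_iff'.1 h1,
      ← mul_apply_eq_comp, h2, ContinuousLinearMap.comp_apply, antilinearAdjoint_inner]
  rw [inner_self_eq_norm_sq_to_K, inner_self_eq_norm_sq_to_K] at h3
  have h4 : ‖antilinearAbs K x‖ ^ 2 = ‖K x‖ ^ 2 := by exact_mod_cast h3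
  exact (sq_eq_sq₀ (norm_nonneg _) (norm_nonneg _)).1 h4

/-- Eigenspaces of `|K|` for distinct eigenvalues are orthogonal, so Pythagoras applies to a finite
sum of eigenvectors before and after applying `|K|`. -/
theorem mul_norm_le_of_mem_eigenspaceGE {K : H →L⋆[ℂ] H} {t : ℝ} (ht : 0 ≤ t) {x : H}
    (hx : x ∈ eigenspaceGE K t) : t * ‖x‖ ≤ ‖K x‖ := by
  have hsa : IsSelfAdjoint (antilinearAbs K) := (antilinearAbs_nonneg K).isSelfAdjoint
  have hsym : (antilinearAbs K : H →ₗ[ℂ] H).IsSymmetric :=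
    ContinuousLinearMap.isSelfAdjoint_iff_isSymmetric.1 hsa
  rw [eigenspaceGE, iSup_subtype', Submodule.mem_iSup_iff_exists_finsupp] at hx
  obtain ⟨f, hf, rfl⟩ := hx
  have horth : ∀ i j, i ≠ j → ⟪f i, f j⟫_ℂ = 0 := by
    intro i j hij
    have hne : ((i : ℝ) : ℂ) ≠ ((j : ℝ) : ℂ) := fun h => hij (Subtype.ext (Complex.ofReal_injective h))
    exact hsym.orthogonalFamily_eigenspaces hne ⟨f i, hf i⟩ ⟨f j, hf j⟩
  have hT : antilinearAbs K (f.sum fun _ y => y) = ∑ i ∈ f.support, (((i : ℝ) : ℂ)) • f i := by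
    rw [Finsupp.sum, map_sum]
    exact Finset.sum_congr rfl fun i _ => Module.End.mem_eigenspace_iff.1 (hf i)
  rw [← norm_antilinearAbs_apply, hT, Finsupp.sum]
  refine le_of_sq_le_sq ?_ (norm_nonneg _)
  rw [mul_pow, norm_sum_sq_of_pairwise_inner_eq_zero _ _ horth,
    norm_sum_sq_of_pairwise_inner_eq_zero, Finset.mul_sum]
  · refine Finset.sum_le_sum fun i _ => ?_
    rw [norm_smul, mul_pow, Complex.norm_real, Real.norm_eq_abs, sq_abs]
    have := i.2
    gcongr
  · intro i j hij
    rw [inner_smul_left, inner_smul_right, horth i j hij, mul_zero, mul_zero]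

/-- One half of the min-max principle for singular values. -/
theorem antilinearSingularValue_le {K : H →L⋆[ℂ] H} {n : ℕ} {η : ℝ} (hη : 0 ≤ η)
    (Z : Submodule ℂ H) [FiniteDimensional ℂ Z] (hZ : Module.finrank ℂ Z ≤ n)
    (h : ∀ x ∈ Zᗮ, ‖K x‖ ≤ η * ‖x‖) : antilinearSingularValue K n ≤ η := by
  refine Real.sSup_le ?_ hη
  rintro t ⟨ht, hrank⟩
  -- The source has larger rank than `Z`, so some nonzero vector of it is orthogonal to `Z`;
  -- comparing the two bounds for `K` on that vector gives `t ≤ η`.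
  let F : eigenspaceGE K t →ₗ[ℂ] Z :=
    (Z.orthogonalProjectionOnto : H →ₗ[ℂ] Z).comp (eigenspaceGE K t).subtype
  have hF : ¬ Function.Injective F := by
    intro hinj
    have h1 := hrank.trans (LinearMap.rank_le_of_injective F hinj)
    rw [← Module.finrank_eq_rank, Nat.cast_le] at h1
    omega
  rw [← LinearMap.ker_eq_bot, Submodule.eq_bot_iff] at hF
  push Not at hF
  obtain ⟨x, hx, hx0⟩ := hF
  have hxZ : (x : H) ∈ Zᗮ := Submodule.orthogonalProjectionOnto_eq_zero_iff.1 hx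
  have hpos : 0 < ‖(x : H)‖ := norm_pos_iff.2 fun h0 => hx0 (Subtype.ext h0)
  exact le_of_mul_le_mul_right ((mul_norm_le_of_mem_eigenspaceGE ht.le x.2).trans (h x hxZ)) hpos

theorem antilinearSingularValue_nonneg (K : H →L⋆[ℂ] H) (n : ℕ) :
    0 ≤ antilinearSingularValue K n :=
  Real.sSup_nonneg fun _ h => h.1.le

/-! ### Takagi diagonalization in finite dimension. -/

/-- An antilinear self-adjoint operator has an eigenvector in every nonzero finite-dimensional
invariant subspace. -/
theorem AntilinearSelfAdjoint.exists_eigenvector {D : H →L⋆[ℂ] H} (hD : AntilinearSelfAdjoint D)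
    (U : Submodule ℂ H) [FiniteDimensional ℂ U] (hU : ∀ x ∈ U, D x ∈ U) (hne : U ≠ ⊥) :
    ∃ x ∈ U, ‖x‖ = 1 ∧ ∃ d : ℂ, D x = d • x := by
  suffices h : ∃ x ∈ U, x ≠ 0 ∧ ∃ d : ℝ, D x = (d : ℂ) • x by
    obtain ⟨x, hxU, hx0, d, hd⟩ := h
    refine ⟨((‖x‖⁻¹ : ℝ) : ℂ) • x, U.smul_mem _ hxU, ?_, d, ?_⟩
    · rw [norm_smul, Complex.norm_real, norm_inv, norm_norm,
        inv_mul_cancel₀ (norm_ne_zero_iff.2 hx0)]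
    · rw [map_smulₛₗ, Complex.conj_ofReal, hd, smul_comm]
  have : Nontrivial U := Submodule.nontrivial_iff_ne_bot.2 hne
  let T : U →ₗ[ℂ] U := (antilinearSq D : H →ₗ[ℂ] H).restrict fun x hx => hU _ (hU x hx)
  obtain ⟨l, hl⟩ := Module.End.exists_eigenvalue T
  obtain ⟨⟨x, hxU⟩, hx⟩ := hl.exists_hasEigenvector
  have hx0 : x ≠ 0 := fun h => hx.2 (Subtype.ext h)
  have hDD : D (D x) = l • x := congrArg Subtype.val hx.apply_eq_smul
  obtain ⟨r, hr, rfl⟩ : ∃ r : ℝ, 0 ≤ r ∧ l = (r : ℂ) := by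
    refine ⟨‖D x‖ ^ 2 / ‖x‖ ^ 2, by positivity, ?_⟩
    have h1 : ⟪x, D (D x)⟫_ℂ = ((‖D x‖ ^ 2 : ℝ) : ℂ) := by
      rw [← inner_conj_symm, hD.inner_comm, inner_self_eq_norm_sq_to_K]
      simp
    rw [hDD, inner_smul_right, inner_self_eq_norm_sq_to_K] at h1
    have h2 : (‖x‖ : ℂ) ≠ 0 := by simpa using hx0
    push_cast at h1 ⊢
    rw [eq_div_iff (pow_ne_zero 2 h2)]
    exact h1
  -- From `D² x = r x`, the vector `D x + √r x` is fixed by `D` up to the factor `√r`; if it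
  -- vanishes, `x` has eigenvalue `-√r`.
  by_cases hy : D x + ((√r : ℝ) : ℂ) • x = 0
  · refine ⟨x, hxU, hx0, -√r, ?_⟩
    rw [eq_neg_of_add_eq_zero_left hy]
    simp
  · refine ⟨_, U.add_mem (hU x hxU) (U.smul_mem _ hxU), hy, √r, ?_⟩
    rw [map_add, map_smulₛₗ, Complex.conj_ofReal, hDD, smul_add, smul_smul, ← Complex.ofReal_mul,
      Real.mul_self_sqrt hr, add_comm]

/-- Takagi diagonalization on a finite-dimensional invariant subspace. -/
theorem AntilinearSelfAdjoint.exists_orthonormal_eigenvectors {D : H →L⋆[ℂ] H}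
    (hD : AntilinearSelfAdjoint D) (U : Submodule ℂ H) [FiniteDimensional ℂ U]
    (hU : ∀ x ∈ U, D x ∈ U) :
    ∃ e : Fin (Module.finrank ℂ U) → H, Orthonormal ℂ e ∧ Submodule.span ℂ (Set.range e) = U ∧
      ∀ i, ∃ d : ℂ, D (e i) = d • e i := by
  induction hn : Module.finrank ℂ U generalizing U with
  | zero =>
    refine ⟨Fin.elim0, ⟨fun i => i.elim0, fun i => i.elim0⟩, ?_, fun i => i.elim0⟩
    rw [Submodule.finrank_eq_zero.1 hn]
    simp
  | succ n ih =>
    obtain ⟨x, hxU, hx1, d, hd⟩ := hD.exists_eigenvector U hU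
      (by rintro rfl; simp at hn)
    have hle : Submodule.span ℂ {x} ≤ U := by
      rwa [Submodule.span_singleton_le_iff_mem]
    have hx0 : x ≠ 0 := norm_ne_zero_iff.1 (by rw [hx1]; exact one_ne_zero)
    have hinv : ∀ y ∈ Submodule.span ℂ {x}, D y ∈ Submodule.span ℂ {x} := by
      intro y hy
      obtain ⟨c, rfl⟩ := Submodule.mem_span_singleton.1 hy
      rw [map_smulₛₗ, hd]
      exact Submodule.smul_mem _ _ (Submodule.smul_mem _ _ (Submodule.mem_span_singleton_self x))
    have hfin : Module.finrank ℂ ((Submodule.span ℂ {x})ᗮ ⊓ U : Submodule ℂ H) = n := by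
      have := Submodule.finrank_add_inf_finrank_orthogonal hle
      rw [finrank_span_singleton hx0, hn] at this
      omega
    obtain ⟨e, he, hspan, heig⟩ := ih ((Submodule.span ℂ {x})ᗮ ⊓ U : Submodule ℂ H)
      (fun y hy => ⟨hD.apply_mem_orthogonal hinv hy.1, hU y hy.2⟩) hfin
    refine ⟨Matrix.vecCons x e, ?_, ?_, ?_⟩
    · refine orthonormal_vecCons_iff.2 ⟨hx1, fun i => ?_, he⟩
      have : e i ∈ ((Submodule.span ℂ {x})ᗮ ⊓ U : Submodule ℂ H) :=
        hspan ▸ Submodule.subset_span ⟨i, rfl⟩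
      exact Submodule.mem_orthogonal_singleton_iff_inner_right.1 this.1
    · rw [Matrix.range_cons, Submodule.span_union, hspan]
      exact Submodule.sup_orthogonal_inf_of_hasOrthogonalProjection hle
    · intro i
      refine Fin.cases ⟨d, hd⟩ (fun j => ?_) i
      simpa using heig j

/-! ### The off-diagonal part relative to a filtration. -/

theorem Submodule.norm_sub_starProjection_le (V : Submodule ℂ H) [V.HasOrthogonalProjection]
    (x : H) : ‖x - V.starProjection x‖ ≤ ‖x‖ := by
  rw [← V.starProjection_orthogonal_val]
  exact Submodule.norm_starProjection_apply_le _ x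

theorem Submodule.norm_sub_starProjection_le_of_mem (V : Submodule ℂ H)
    [V.HasOrthogonalProjection] (x : H) {v : H} (hv : v ∈ V) :
    ‖x - V.starProjection x‖ ≤ ‖x - v‖ := by
  have := V.norm_sub_starProjection_le (x - v)
  rwa [map_sub, Submodule.starProjection_eq_self_iff.2 hv, sub_sub_sub_cancel_right] at this

/-- With `P` the projection onto `V`, `P A (1 - P)` is the adjoint of `(1 - P) A P`, whose norm is
at most `h` by almost invariance. -/
theorem AntilinearSelfAdjoint.norm_starProjection_apply_le {A : H →L⋆[ℂ] H}
    (hA : AntilinearSelfAdjoint A) {V : Submodule ℂ H} [V.HasOrthogonalProjection] {h : ℝ}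
    (hh : 0 ≤ h) (hV : ∀ w ∈ V, ∃ w' ∈ V, ‖A w - w'‖ ≤ h * ‖w‖) (x : H) :
    ‖V.starProjection (A (x - V.starProjection x))‖ ≤ h * ‖x‖ := by
  set y := V.starProjection (A (x - V.starProjection x)) with hy
  have hyV : y ∈ V := V.starProjection_apply_mem _
  obtain ⟨w', hw', hle⟩ := hV y hyV
  have h1 : ⟪y, y⟫_ℂ = ⟪A y - V.starProjection (A y), x⟫_ℂ := by
    calc ⟪y, y⟫_ℂ = ⟪A (x - V.starProjection x), y⟫_ℂ := by
          conv_lhs => rw [hy, Submodule.inner_starProjection_left_eq_right,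
            Submodule.starProjection_eq_self_iff.2 hyV]
      _ = ⟪A y - V.starProjection (A y), x⟫_ℂ := by
          rw [hA.inner_comm, inner_sub_left, inner_sub_right,
            Submodule.inner_starProjection_left_eq_right]
  have h2 : ‖y‖ * ‖y‖ ≤ (h * ‖y‖) * ‖x‖ := by
    calc ‖y‖ * ‖y‖ = ‖⟪y, y⟫_ℂ‖ := by
          rw [inner_self_eq_norm_sq_to_K]
          simp [sq]
      _ ≤ ‖A y - V.starProjection (A y)‖ * ‖x‖ := by
          rw [h1]
          exact norm_inner_le_norm _ _
      _ ≤ (h * ‖y‖) * ‖x‖ := by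
          gcongr
          exact (V.norm_sub_starProjection_le_of_mem _ hw').trans hle
  rcases (norm_nonneg y).eq_or_lt with h0 | h0
  · rw [← h0]
    positivity
  · exact le_of_mul_le_mul_right (h2.trans_eq (by ring)) h0

/-- The projection onto the `m`-th block of a filtration. -/
def blockProj (V : ℕ → Submodule ℂ H) [∀ m, (V m).HasOrthogonalProjection] (m : ℕ) : H →L[ℂ] H :=
  (V (m + 1)).starProjection - (V m).starProjection

/-- The part of `A` that maps the `m`-th block out of the filtration step `V (m + 1)`, together
with its adjoint. -/
def offDiagonal (A : H →L⋆[ℂ] H) (V : ℕ → Submodule ℂ H) [∀ m, (V m).HasOrthogonalProjection]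
    (m : ℕ) : H →L⋆[ℂ] H :=
  ((1 - (V (m + 1)).starProjection : H →L[ℂ] H).comp (A.comp (blockProj V m)) : H →L⋆[ℂ] H) +
    ((blockProj V m).comp (A.comp (1 - (V (m + 1)).starProjection : H →L[ℂ] H)) : H →L⋆[ℂ] H)

section Filtration

variable {A : H →L⋆[ℂ] H} {V : ℕ → Submodule ℂ H} [∀ m, (V m).HasOrthogonalProjection]

theorem blockProj_apply (m : ℕ) (x : H) :
    blockProj V m x = (V (m + 1)).starProjection x - (V m).starProjection x := rfl

theorem inner_blockProj_left (m : ℕ) (x y : H) :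
    ⟪blockProj V m x, y⟫_ℂ = ⟪x, blockProj V m y⟫_ℂ := by
  rw [blockProj_apply, blockProj_apply, inner_sub_left, inner_sub_right,
    Submodule.inner_starProjection_left_eq_right, Submodule.inner_starProjection_left_eq_right]

theorem blockProj_eq_starProjection_sub (hV : Monotone V) (m : ℕ) (x : H) :
    blockProj V m x = (V (m + 1)).starProjection (x - (V m).starProjection x) := by
  rw [map_sub, Submodule.starProjection_starProjection_of_ge (hV m.le_succ), blockProj_apply]

theorem blockProj_eq_sub_starProjection (hV : Monotone V) (m : ℕ) (x : H) :
    blockProj V m x = (V (m + 1)).starProjection x -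
      (V m).starProjection ((V (m + 1)).starProjection x) := by
  rw [Submodule.starProjection_starProjection_of_le (hV m.le_succ), blockProj_apply]

theorem offDiagonal_apply (m : ℕ) (x : H) :
    offDiagonal A V m x =
      (A (blockProj V m x) - (V (m + 1)).starProjection (A (blockProj V m x))) +
        blockProj V m (A (x - (V (m + 1)).starProjection x)) := rfl

theorem AntilinearSelfAdjoint.offDiagonal (hA : AntilinearSelfAdjoint A) (m : ℕ) :
    AntilinearSelfAdjoint (offDiagonal A V m) := by
  have key : ∀ x y : H,
      ⟪A (blockProj V m x) - (V (m + 1)).starProjection (A (blockProj V m x)), y⟫_ℂ =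
        ⟪blockProj V m (A (y - (V (m + 1)).starProjection y)), x⟫_ℂ := fun x y => by
    rw [inner_blockProj_left, hA.inner_comm, inner_sub_left, inner_sub_right,
      Submodule.inner_starProjection_left_eq_right]
  refine antilinearSelfAdjoint_of_inner_comm fun x y => ?_
  rw [offDiagonal_apply, offDiagonal_apply, inner_add_left, inner_add_left, key, ← key y x, add_comm]

theorem AntilinearSelfAdjoint.norm_offDiagonal_apply_le (hA : AntilinearSelfAdjoint A)
    (hV : Monotone V) {m : ℕ} {h : ℝ} (hh : 0 ≤ h)
    (hinv : ∀ w ∈ V (m + 1), ∃ w' ∈ V (m + 1), ‖A w - w'‖ ≤ h * ‖w‖) (x : H) :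
    ‖_root_.offDiagonal A V m x‖ ≤ 2 * h * ‖x‖ := by
  rw [offDiagonal_apply]
  have h1 : ‖A (blockProj V m x) - (V (m + 1)).starProjection (A (blockProj V m x))‖ ≤
      h * ‖x‖ := by
    have hmem : blockProj V m x ∈ V (m + 1) := by
      rw [blockProj_eq_starProjection_sub hV]
      exact Submodule.starProjection_apply_mem _ _
    obtain ⟨w', hw', hle⟩ := hinv _ hmem
    refine ((Submodule.norm_sub_starProjection_le_of_mem _ _ hw').trans hle).trans ?_
    gcongr
    rw [blockProj_eq_starProjection_sub hV]
    exact (Submodule.norm_starProjection_apply_le _ _).trans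
      (Submodule.norm_sub_starProjection_le _ _)
  have h2 : ‖blockProj V m (A (x - (V (m + 1)).starProjection x))‖ ≤ h * ‖x‖ := by
    rw [blockProj_eq_sub_starProjection hV]
    exact (Submodule.norm_sub_starProjection_le _ _).trans (hA.norm_starProjection_apply_le hh hinv x)
  linarith [norm_add_le (A (blockProj V m x) - (V (m + 1)).starProjection (A (blockProj V m x)))
    (blockProj V m (A (x - (V (m + 1)).starProjection x)))]

theorem isCompactOperator_starProjection (W : Submodule ℂ H) [FiniteDimensional ℂ W] :
    IsCompactOperator W.starProjection := by
  have := FiniteDimensional.proper ℂ W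
  have h : IsCompactOperator W.orthogonalProjectionOnto :=
    isCompactOperator_of_locallyCompactSpace_dom W.orthogonalProjectionOnto
  exact h.clm_comp W.subtypeL

theorem isCompactOperator_offDiagonal [∀ m, FiniteDimensional ℂ (V m)] (m : ℕ) :
    IsCompactOperator (offDiagonal A V m) := by
  have hB : IsCompactOperator (blockProj V m) :=
    (isCompactOperator_starProjection (V (m + 1))).sub (isCompactOperator_starProjection (V m))
  refine IsCompactOperator.add ?_ ?_
  · exact (hB.clm_comp A).clm_comp (1 - (V (m + 1)).starProjection : H →L[ℂ] H)
  · exact hB.comp_clm (A.comp (1 - (V (m + 1)).starProjection : H →L[ℂ] H))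

theorem blockProj_apply_eq_zero (hV : Monotone V) {j m : ℕ} (hjm : j < m) {x : H}
    (hx : x ∈ (V m)ᗮ) : blockProj V j x = 0 := by
  have h : ∀ i, i ≤ m → (V i).starProjection x = 0 := fun i hi =>
    (Submodule.starProjection_apply_eq_zero_iff _).2 (Submodule.orthogonal_le (hV hi) hx)
  rw [blockProj_apply, h _ hjm, h _ hjm.le, sub_zero]

theorem offDiagonal_apply_of_mem_orthogonal (hV : Monotone V) {j m : ℕ} (hjm : j < m) {x : H}
    (hx : x ∈ (V m)ᗮ) : offDiagonal A V j x = blockProj V j (A x) := by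
  have h : (V (j + 1)).starProjection x = 0 :=
    (Submodule.starProjection_apply_eq_zero_iff _).2 (Submodule.orthogonal_le (hV hjm) hx)
  rw [offDiagonal_apply, blockProj_apply_eq_zero hV hjm hx, h]
  simp

theorem offDiagonal_apply_of_mem (hV : Monotone V) {j m : ℕ} (hmj : m ≤ j) {x : H}
    (hx : x ∈ V m) : offDiagonal A V j x = 0 := by
  have h : ∀ i, m ≤ i → (V i).starProjection x = x := fun i hi =>
    Submodule.starProjection_eq_self_iff.2 (hV hi hx)
  rw [offDiagonal_apply, blockProj_apply, h _ hmj, h _ (by omega)]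
  simp

theorem offDiagonal_apply_of_mem_block {m : ℕ} {x : H}
    (hx : x ∈ V (m + 1)) (hx' : x ∈ (V m)ᗮ) :
    offDiagonal A V m x = A x - (V (m + 1)).starProjection (A x) := by
  have h1 : (V (m + 1)).starProjection x = x := Submodule.starProjection_eq_self_iff.2 hx
  have h2 : (V m).starProjection x = 0 := (Submodule.starProjection_apply_eq_zero_iff _).2 hx'
  rw [offDiagonal_apply, blockProj_apply, h1, h2]
  simp

theorem hasSum_antilinear_apply {ι : Type*} {f : ι → H →L⋆[ℂ] H} {K : H →L⋆[ℂ] H}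
    (h : HasSum f K) (x : H) : HasSum (fun i => f i x) (K x) :=
  h.mapL (ContinuousLinearMap.apply' H (starRingEnd ℂ) x)

/-- Subtracting the sum of the off-diagonal parts makes `A` block diagonal. -/
theorem sub_offDiagonal_apply_mem (hV : Monotone V) (hV0 : V 0 = ⊥) {K : H →L⋆[ℂ] H}
    (hK : HasSum (offDiagonal A V) K) {m : ℕ} {x : H} (hx : x ∈ (V m)ᗮ ⊓ V (m + 1)) :
    (A - K) x ∈ (V m)ᗮ ⊓ V (m + 1) := by
  -- Terms beyond `m` vanish on `V (m + 1)`. Those below `m` telescope to the projection of `A x`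
  -- onto `V m`, and the `m`-th is the component of `A x` orthogonal to `V (m + 1)`; subtracting
  -- them leaves the block component.
  have h1 : K x = ∑ j ∈ Finset.range (m + 1), offDiagonal A V j x := by
    refine (hasSum_antilinear_apply hK x).unique (hasSum_sum_of_ne_finset_zero fun j hj => ?_)
    exact offDiagonal_apply_of_mem hV (by simpa using hj) hx.2
  have h0 : (V 0).starProjection (A x) = 0 := by
    rw [Submodule.starProjection_apply_eq_zero_iff, hV0, Submodule.bot_orthogonal_eq_top]
    trivial
  have h2 : ∑ j ∈ Finset.range m, offDiagonal A V j x = (V m).starProjection (A x) := by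
    rw [Finset.sum_congr rfl fun j hj =>
      offDiagonal_apply_of_mem_orthogonal hV (Finset.mem_range.1 hj) hx.1]
    simp only [blockProj_apply]
    rw [Finset.sum_range_sub (fun j => (V j).starProjection (A x)), h0, sub_zero]
  have h3 : (A - K) x = blockProj V m (A x) := by
    rw [sub_apply, h1, Finset.sum_range_succ, h2, offDiagonal_apply_of_mem_block hx.2 hx.1,
      blockProj_apply]
    abel
  rw [h3]
  constructor
  · rw [blockProj_eq_sub_starProjection hV]
    exact Submodule.sub_starProjection_mem_orthogonal _
  · rw [blockProj_eq_starProjection_sub hV]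
    exact Submodule.starProjection_apply_mem _ _

theorem le_iSup_block (hV0 : V 0 = ⊥) (hV : Monotone V) (m : ℕ) :
    V m ≤ ⨆ j, (V j)ᗮ ⊓ V (j + 1) := by
  induction m with
  | zero => rw [hV0]; exact bot_le
  | succ m ih =>
    rw [← Submodule.sup_orthogonal_inf_of_hasOrthogonalProjection (hV m.le_succ)]
    exact sup_le ih (le_iSup (fun j => (V j)ᗮ ⊓ V (j + 1)) m)

/-- A self-adjoint antilinear operator that is block diagonal with finite-dimensional blocks is
diagonalizable. -/
theorem AntilinearSelfAdjoint.diagonalizable_of_blocks {D : H →L⋆[ℂ] H}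
    (hD : AntilinearSelfAdjoint D) [∀ m, FiniteDimensional ℂ (V m)] (hV : Monotone V)
    (hV0 : V 0 = ⊥) (hdense : ⊤ ≤ (⨆ m, V m).topologicalClosure)
    (hDV : ∀ m, ∀ x ∈ (V m)ᗮ ⊓ V (m + 1), D x ∈ (V m)ᗮ ⊓ V (m + 1)) :
    AntilinearDiagonalizable D := by
  have hfd : ∀ m, FiniteDimensional ℂ ((V m)ᗮ ⊓ V (m + 1) : Submodule ℂ H) := fun m =>
    Submodule.finiteDimensional_of_le inf_le_right
  choose e he hspan heig using fun m => hD.exists_orthonormal_eigenvectors _ (hDV m)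
  choose d hd using heig
  have hmem : ∀ m i, e m i ∈ (V m)ᗮ ⊓ V (m + 1) := fun m i =>
    hspan m ▸ Submodule.subset_span ⟨i, rfl⟩
  have horth : ∀ m n, m < n → ∀ i j, ⟪e m i, e n j⟫_ℂ = 0 := fun m n hmn i j =>
    (hmem n j).1 _ (hV hmn (hmem m i).2)
  -- `AntilinearDiagonalizable` asks for an index type in the universe of `H`.
  let v : ULift.{u} (Σ m, Fin (Module.finrank ℂ ((V m)ᗮ ⊓ V (m + 1) : Submodule ℂ H))) → H :=
    fun i => e i.down.1 i.down.2
  have hv : Orthonormal ℂ v := by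
    refine ⟨fun i => (he _).1 _, ?_⟩
    rintro ⟨m, i⟩ ⟨n, j⟩ hne
    change ⟪e m i, e n j⟫_ℂ = 0
    rcases lt_trichotomy m n with hmn | rfl | hmn
    · exact horth m n hmn i j
    · exact (he m).2 fun hij => hne (by rw [hij])
    · rw [← inner_conj_symm, horth n m hmn j i, map_zero]
  have htop : ⊤ ≤ (Submodule.span ℂ (Set.range v)).topologicalClosure := by
    refine hdense.trans (Submodule.topologicalClosure_mono (iSup_le fun m => ?_))
    refine (le_iSup_block hV0 hV m).trans (iSup_le fun j => ?_)
    rw [← hspan j]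
    refine Submodule.span_mono ?_
    rintro _ ⟨i, rfl⟩
    exact ⟨⟨j, i⟩, rfl⟩
  refine ⟨_, HilbertBasis.mk hv htop, fun i => d i.down.1 i.down.2, fun i => ?_⟩
  rw [HilbertBasis.coe_mk]
  exact hd _ _

theorem AntilinearSelfAdjoint.of_hasSum {ι : Type*} {f : ι → H →L⋆[ℂ] H} {K : H →L⋆[ℂ] H}
    (hf : ∀ i, AntilinearSelfAdjoint (f i)) (h : HasSum f K) : AntilinearSelfAdjoint K := by
  refine antilinearSelfAdjoint_of_inner_comm fun x y => ?_
  have key : ∀ x y : H, HasSum (fun i => ⟪y, f i x⟫_ℂ) ⟪y, K x⟫_ℂ := fun x y =>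
    (hasSum_antilinear_apply h x).mapL (innerSL ℂ y)
  rw [← inner_conj_symm, ← inner_conj_symm (K y) x, (key x y).unique ?_]
  refine (key y x).congr_fun ?_
  intro i
  rw [← inner_conj_symm, (hf i).inner_comm, inner_conj_symm]

theorem AntilinearSelfAdjoint.sub {A B : H →L⋆[ℂ] H} (hA : AntilinearSelfAdjoint A)
    (hB : AntilinearSelfAdjoint B) : AntilinearSelfAdjoint (A - B) :=
  antilinearSelfAdjoint_of_inner_comm fun x y => by
    rw [sub_apply, sub_apply, inner_sub_left, inner_sub_left, hA.inner_comm, hB.inner_comm]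

/-- Away from `V m` and its image under `A` only the tail of the off-diagonal parts matters. -/
theorem norm_apply_le_of_hasSum_offDiagonal (hA : AntilinearSelfAdjoint A) (hV : Monotone V)
    {h : ℕ → ℝ} (hh : ∀ m, 0 ≤ h m) (hhalf : ∀ m, h (m + 1) ≤ h m / 2)
    (hinv : ∀ m, ∀ w ∈ V (m + 1), ∃ w' ∈ V (m + 1), ‖A w - w'‖ ≤ h m * ‖w‖)
    {K : H →L⋆[ℂ] H} (hK : HasSum (offDiagonal A V) K) (m : ℕ) {x : H}
    (hx : x ∈ (V m)ᗮ) (hx' : A x ∈ (V m)ᗮ) : ‖K x‖ ≤ 4 * h m * ‖x‖ := by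
  have h1 := hasSum_antilinear_apply hK x
  have h2 : HasSum (fun i => offDiagonal A V (i + m) x) (K x) := by
    rw [hasSum_nat_add_iff' (f := fun i => offDiagonal A V i x) m |>.symm] at h1
    rwa [Finset.sum_eq_zero fun j hj => ?_, sub_zero] at h1
    rw [offDiagonal_apply_of_mem_orthogonal hV (Finset.mem_range.1 hj) hx,
      blockProj_apply_eq_zero hV (Finset.mem_range.1 hj) hx']
  have h3 : ∀ i, h (i + m) ≤ h m * (1 / 2) ^ i := by
    intro i
    induction i with
    | zero => simp
    | succ i ih =>
      have := hhalf (i + m)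
      rw [Nat.add_right_comm, pow_succ]
      linarith
  -- The constant `4` is the `2` of the single-term bound times the geometric sum `2`.
  have h4 : HasSum (fun i : ℕ => 2 * h m * ‖x‖ * (1 / 2 : ℝ) ^ i) (2 * h m * ‖x‖ * 2) :=
    hasSum_geometric_two.mul_left _
  rw [← h2.tsum_eq]
  refine (tsum_of_norm_bounded h4 fun i => ?_).trans_eq (by ring)
  refine (hA.norm_offDiagonal_apply_le hV (hh _) (hinv _) x).trans ?_
  calc 2 * h (i + m) * ‖x‖ ≤ 2 * (h m * (1 / 2) ^ i) * ‖x‖ := by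
        gcongr
        exact h3 i
    _ = 2 * h m * ‖x‖ * (1 / 2) ^ i := by ring

/-- Min-max is applied to `V m + A (V m)`, of dimension at most `2 dim (V m)`. By self-adjointness,
`x ⊥ A (V m)` gives `A x ⊥ V m`, as the tail estimate requires. -/
theorem antilinearSingularValue_le_of_hasSum_offDiagonal [∀ m, FiniteDimensional ℂ (V m)]
    (hA : AntilinearSelfAdjoint A) (hV : Monotone V)
    {h : ℕ → ℝ} (hh : ∀ m, 0 ≤ h m) (hhalf : ∀ m, h (m + 1) ≤ h m / 2)
    (hinv : ∀ m, ∀ w ∈ V (m + 1), ∃ w' ∈ V (m + 1), ‖A w - w'‖ ≤ h m * ‖w‖)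
    {K : H →L⋆[ℂ] H} (hK : HasSum (offDiagonal A V) K) (m n : ℕ)
    (hn : 2 * Module.finrank ℂ (V m) ≤ n) : antilinearSingularValue K n ≤ 4 * h m := by
  let b := Module.finBasis ℂ (V m)
  let Y : Submodule ℂ H := Submodule.span ℂ (Set.range fun i => A (b i))
  have hY : FiniteDimensional ℂ Y := FiniteDimensional.span_of_finite ℂ (Set.finite_range _)
  have hAY : ∀ v ∈ V m, A v ∈ Y := by
    intro v hv
    have h1 : ((∑ j, b.repr ⟨v, hv⟩ j • b j : V m) : H) = v := by rw [b.sum_repr]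
    rw [← h1, Submodule.coe_sum, map_sum]
    refine Submodule.sum_mem _ fun j _ => ?_
    rw [Submodule.coe_smul, map_smulₛₗ]
    exact Y.smul_mem _ (Submodule.subset_span ⟨j, rfl⟩)
  have hrank : Module.finrank ℂ (V m ⊔ Y : Submodule ℂ H) ≤ n := by
    have h1 := Submodule.finrank_add_le_finrank_add_finrank (V m) Y
    have h2 : Module.finrank ℂ Y ≤ Module.finrank ℂ (V m) := by
      exact (finrank_range_le_card (R := ℂ) fun i => A (b i)).trans_eq (Fintype.card_fin _)
    omega
  refine antilinearSingularValue_le (mul_nonneg (by norm_num) (hh m)) (V m ⊔ Y) hrank fun x hx => ?_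
  refine norm_apply_le_of_hasSum_offDiagonal hA hV hh hhalf hinv hK m
    (Submodule.orthogonal_le le_sup_left hx) ?_
  rw [Submodule.mem_orthogonal']
  intro v hv
  rw [hA.inner_comm]
  exact Submodule.orthogonal_le le_sup_right hx _ (hAY v hv)

end Filtration

/-! ### Construction of the filtration. -/

open Filter Topology in
/-- One step of the construction of the filtration: the new subspace contains a given vector, and
its dimension is small compared with the invariance error. -/
theorem AntilinearSelfAdjoint.exists_filtration_step {A : H →L⋆[ℂ] H}
    (hA : AntilinearSelfAdjoint A) {p : ℝ} (hp : 1 < p) (V : Submodule ℂ H)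
    [FiniteDimensional ℂ V] (f : H) {η δ : ℝ} (hη : 0 < η) (hδ : 0 < δ) :
    ∃ (W : Submodule ℂ H) (h : ℝ), FiniteDimensional ℂ W ∧ 0 < h ∧ V ≤ W ∧ f ∈ W ∧ h ≤ η / 2 ∧
      2 * Module.finrank ℂ W * (4 * h) ^ p ≤ δ ∧
      ∀ w ∈ W, ∃ w' ∈ W, ‖A w - w'‖ ≤ h * ‖w‖ := by
  let U : Submodule ℂ H := V ⊔ Submodule.span ℂ {f}
  set C : ℝ := (‖A‖ + 2) * (Module.finrank ℂ U * 2) with hC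
  -- The dimension bound `C / h` costs one power of `h`; the remaining exponent `p - 1` is positive
  -- exactly because `p > 1`.
  have hlim : Tendsto (fun h : ℝ => 2 * C * 4 ^ p * h ^ (p - 1)) (𝓝[>] 0) (𝓝 0) := by
    have h1 : Tendsto (fun h : ℝ => h ^ (p - 1)) (𝓝[>] 0) (𝓝 0) := by
      have := (Real.continuousAt_rpow_const 0 (p - 1) (Or.inr (by linarith))).tendsto
      rw [Real.zero_rpow (by linarith)] at this
      exact this.mono_left nhdsWithin_le_nhds
    simpa using h1.const_mul (2 * C * 4 ^ p)
  have hev : ∀ᶠ h : ℝ in 𝓝[>] 0, h < min (η / 2) 1 :=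
    nhdsWithin_le_nhds (eventually_lt_nhds (lt_min (by positivity) one_pos))
  obtain ⟨h, ⟨hsmall, hmin⟩, hpos⟩ :=
    (((hlim.eventually_lt_const hδ).and hev).and self_mem_nhdsWithin).exists
  have hpos : 0 < h := hpos
  obtain ⟨W, hUW, hW, hrank, hinv⟩ :=
    hA.exists_almost_invariant_finrank_le U hpos (hmin.le.trans (min_le_right _ _))
  refine ⟨W, h, hW, hpos, le_sup_left.trans hUW,
    hUW (Submodule.mem_sup_right (Submodule.mem_span_singleton_self f)),
    hmin.le.trans (min_le_left _ _), ?_, hinv⟩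
  calc 2 * Module.finrank ℂ W * (4 * h) ^ p ≤ 2 * (C / h) * (4 * h) ^ p := by gcongr
    _ = 2 * C * 4 ^ p * h ^ (p - 1) := by
      rw [Real.mul_rpow (by norm_num) hpos.le, Real.rpow_sub_one hpos.ne']
      ring
    _ ≤ δ := hsmall.le

/-- A filtration of `H` by finite-dimensional subspaces that are almost invariant under `A`. -/
theorem AntilinearSelfAdjoint.exists_filtration [TopologicalSpace.SeparableSpace H]
    {A : H →L⋆[ℂ] H} (hA : AntilinearSelfAdjoint A) {p : ℝ} (hp : 1 < p) {δ : ℝ} (hδ : 0 < δ) :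
    ∃ (V : ℕ → Submodule ℂ H) (h : ℕ → ℝ), (∀ m, FiniteDimensional ℂ (V m)) ∧ Monotone V ∧
      V 0 = ⊥ ∧ ⊤ ≤ (⨆ m, V m).topologicalClosure ∧ (∀ m, 0 ≤ h m) ∧
      (∀ m, h (m + 1) ≤ h m / 2) ∧
      (∀ m, 2 * Module.finrank ℂ (V (m + 1)) * (4 * h m) ^ p ≤ δ / 2 / 2 ^ m) ∧
      ∀ m, ∀ w ∈ V (m + 1), ∃ w' ∈ V (m + 1), ‖A w - w'‖ ≤ h m * ‖w‖ := by
  let State := {s : Submodule ℂ H × ℝ // FiniteDimensional ℂ s.1 ∧ 0 < s.2}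
  have hstep : ∀ (m : ℕ) (s : State), ∃ t : State, s.1.1 ≤ t.1.1 ∧
      TopologicalSpace.denseSeq H m ∈ t.1.1 ∧ t.1.2 ≤ s.1.2 / 2 ∧
      2 * Module.finrank ℂ t.1.1 * (4 * t.1.2) ^ p ≤ δ / 2 / 2 ^ m ∧
      ∀ w ∈ t.1.1, ∃ w' ∈ t.1.1, ‖A w - w'‖ ≤ t.1.2 * ‖w‖ := by
    intro m s
    have := s.2.1
    obtain ⟨W, h, hW, hpos, h1, h2, h3, h4, h5⟩ := hA.exists_filtration_step hp s.1.1
      (TopologicalSpace.denseSeq H m) s.2.2 (show 0 < δ / 2 / 2 ^ m by positivity)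
    exact ⟨⟨(W, h), hW, hpos⟩, h1, h2, h3, h4, h5⟩
  choose next hnext using hstep
  -- The initial error `1` is a dummy: the error sequence is shifted, so that `h m` belongs to `V (m
  -- + 1)`.
  let s : ℕ → State := fun m =>
    Nat.rec (motive := fun _ => State) ⟨(⊥, 1), inferInstance, one_pos⟩ next m
  have hs : ∀ m, s (m + 1) = next m (s m) := fun m => rfl
  refine ⟨fun m => (s m).1.1, fun m => (s (m + 1)).1.2, fun m => (s m).2.1,
    monotone_nat_of_le_succ fun m => (hnext m (s m)).1, rfl, ?_, fun m => (s (m + 1)).2.2.le,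
    fun m => (hnext (m + 1) (s (m + 1))).2.2.1, fun m => (hnext m (s m)).2.2.2.1,
    fun m => (hnext m (s m)).2.2.2.2⟩
  rintro x -
  refine closure_mono ?_ (TopologicalSpace.denseRange_denseSeq H x)
  rintro _ ⟨m, rfl⟩
  exact le_iSup (fun m => (s m).1.1) (m + 1) (hnext m (s m)).2.1

/-! ### Summation of the singular values and conclusion. -/

theorem le_mul_half_pow {h : ℕ → ℝ} (hhalf : ∀ m, h (m + 1) ≤ h m / 2) (m : ℕ) :
    h m ≤ h 0 * (1 / 2) ^ m := by
  induction m with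
  | zero => simp
  | succ m ih =>
    have := hhalf m
    rw [pow_succ]
    linarith

/-- Each index `n` with `d m ≤ n < d (m + 1)` contributes at most `h m ^ p`. Charging this to all `n
< d (m + 1)` only overcounts, and the charges `δ / 2 ^ (m + 1)` add up to `δ`. -/
theorem antilinearSchattenNorm_le {K : H →L⋆[ℂ] H} {p δ : ℝ} (hp : 0 < p)
    {d : ℕ → ℕ} {h : ℕ → ℝ} (hd0 : d 0 = 0)
    (hhalf : ∀ m, h (m + 1) ≤ h m / 2)
    (hsv : ∀ m n, d m ≤ n → antilinearSingularValue K n ≤ h m)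
    (hsum : ∀ m, d (m + 1) * h m ^ p ≤ δ / 2 / 2 ^ m) (hδ : 0 ≤ δ) :
    antilinearSchattenNorm p K ≤ ENNReal.ofReal δ ^ (1 / p) := by
  refine ENNReal.rpow_le_rpow ?_ (by positivity)
  have hpt : ∀ n, ENNReal.ofReal (antilinearSingularValue K n) ^ p ≤
      ∑' m, if n < d (m + 1) then ENNReal.ofReal (h m ^ p) else 0 := by
    intro n
    by_cases hex : ∃ m, n < d (m + 1)
    · classical
      have hle : d (Nat.find hex) ≤ n := by
        rcases hm : Nat.find hex with _ | m
        · simp [hd0]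
        · exact not_lt.1 (Nat.find_min hex (by omega))
      refine le_trans ?_ (ENNReal.le_tsum (Nat.find hex))
      rw [if_pos (Nat.find_spec hex), ENNReal.ofReal_rpow_of_nonneg
        (antilinearSingularValue_nonneg K n) hp.le]
      exact ENNReal.ofReal_le_ofReal (Real.rpow_le_rpow (antilinearSingularValue_nonneg K n)
        (hsv _ _ hle) hp.le)
    -- If `n` lies beyond every `d m`, its singular value is below every `h m` and hence zero.
    · push Not at hex
      have hle : ∀ m, antilinearSingularValue K n ≤ h 0 * (1 / 2) ^ m := by
        intro m
        refine (hsv m n ?_).trans (le_mul_half_pow hhalf m)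
        cases m with
        | zero => simp [hd0]
        | succ m => exact hex m
      have h0 : antilinearSingularValue K n ≤ 0 := by
        have hlim := (tendsto_pow_atTop_nhds_zero_of_lt_one (r := (1 / 2 : ℝ)) (by norm_num)
          (by norm_num)).const_mul (h 0)
        rw [mul_zero] at hlim
        exact ge_of_tendsto' hlim hle
      rw [ENNReal.ofReal_of_nonpos h0, ENNReal.zero_rpow_of_pos hp]
      exact zero_le
  have hinner : ∀ m, ∑' n, (if n < d (m + 1) then ENNReal.ofReal (h m ^ p) else 0) =
      ENNReal.ofReal (d (m + 1) * h m ^ p) := by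
    intro m
    rw [tsum_eq_sum (s := Finset.range (d (m + 1))) fun n hn => if_neg (by simpa using hn),
      Finset.sum_congr rfl fun n hn => if_pos (Finset.mem_range.1 hn), Finset.sum_const,
      Finset.card_range, nsmul_eq_mul, ENNReal.ofReal_mul (Nat.cast_nonneg _),
      ENNReal.ofReal_natCast]
  calc ∑' n, ENNReal.ofReal (antilinearSingularValue K n) ^ p
      ≤ ∑' n, ∑' m, (if n < d (m + 1) then ENNReal.ofReal (h m ^ p) else 0) :=
        ENNReal.tsum_le_tsum hpt
    _ = ∑' m, ENNReal.ofReal (d (m + 1) * h m ^ p) := by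
        rw [ENNReal.tsum_comm]
        exact tsum_congr hinner
    _ ≤ ∑' m : ℕ, ENNReal.ofReal (δ / 2 / 2 ^ m) :=
        ENNReal.tsum_le_tsum fun m => ENNReal.ofReal_le_ofReal (hsum m)
    _ = ENNReal.ofReal δ := by
        rw [← ENNReal.ofReal_tsum_of_nonneg (fun m => by positivity) (summable_geometric_two' δ),
          tsum_geometric_two']

end

theorem theorem4p2 {H : Type*} [NormedAddCommGroup H] [InnerProductSpace ℂ H] [CompleteSpace H]
    [TopologicalSpace.SeparableSpace H] (A : H →L⋆[ℂ] H) (hA : AntilinearSelfAdjoint A)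
    (ε : ℝ) (hε : 0 < ε) (p : ℝ) (hp : 1 < p) :
    ∃ D : H →L⋆[ℂ] H, AntilinearSelfAdjoint D ∧ AntilinearDiagonalizable D ∧
      IsCompactOperator (A - D) ∧ antilinearSchattenNorm p (A - D) < ENNReal.ofReal ε := by
  have hp0 : 0 < p := one_pos.trans hp
  -- The choice `δ = (ε / 2) ^ p` bounds the Schatten norm by `ε / 2`, leaving room for the strict
  -- inequality.
  obtain ⟨V, h, hfin, hV, hV0, hdense, hh, hhalf, hsmall, hinv⟩ :=
    hA.exists_filtration hp (δ := (ε / 2) ^ p) (by positivity)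
  have hsummable : Summable (offDiagonal A V) := by
    refine Summable.of_norm_bounded (g := fun m => 2 * h 0 * (1 / 2) ^ m)
      (summable_geometric_two.mul_left _) fun m => ?_
    refine ContinuousLinearMap.opNorm_le_bound _ (by have := hh 0; positivity) fun x => ?_
    refine (hA.norm_offDiagonal_apply_le hV (hh m) (hinv m) x).trans ?_
    have := le_mul_half_pow hhalf m
    rw [mul_assoc 2 (h 0)]
    gcongr
  obtain ⟨K, hK⟩ := hsummable
  have hKsa : AntilinearSelfAdjoint K := .of_hasSum (fun m => hA.offDiagonal m) hK
  have hKcompact : IsCompactOperator K :=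
    isCompactOperator_of_tendsto hK (Filter.Eventually.of_forall fun s =>
      sum_mem (S := compactOperator (starRingEnd ℂ) H H) fun m _ => isCompactOperator_offDiagonal m)
  have hDsa : AntilinearSelfAdjoint (A - K) := hA.sub hKsa
  refine ⟨A - K, hDsa, hDsa.diagonalizable_of_blocks hV hV0 hdense
    fun m x hx => sub_offDiagonal_apply_mem hV hV0 hK hx, ?_, ?_⟩
  · rwa [sub_sub_cancel]
  · rw [sub_sub_cancel]
    refine (antilinearSchattenNorm_le hp0 (d := fun m => 2 * Module.finrank ℂ (V m))
      (h := fun m => 4 * h m) (δ := (ε / 2) ^ p) (by simp [hV0])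
      (fun m => by have := hhalf m; linarith)
      (fun m n hn => antilinearSingularValue_le_of_hasSum_offDiagonal hA hV hh hhalf hinv hK m n hn)
      (fun m => by simpa using hsmall m) (by positivity)).trans_lt ?_
    rw [← ENNReal.ofReal_rpow_of_pos (by positivity), ← ENNReal.rpow_mul, mul_one_div_cancel hp0.ne',
      ENNReal.rpow_one]
    exact (ENNReal.ofReal_lt_ofReal_iff hε).2 (by linarith)
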